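/- Let $f_1,\dots,f_n$, $f_i:\mathbb R^{d_i}\to\mathbb R\cup\{+\infty\}$, be proper, lower semicontinuous, 1-coercive ($f_i(x)/\|x\|\to+\infty$ as $\|x\|\to\infty$) and minorized by an affine function, let $A=(A_1,\dots,A_n)$ with $A_i\in\mathbb R^{m\times d_i}$, and let $b\in\mathbb R^m$. Let $f_i^{**}$ be the biconjugate (convex envelope) of $f_i$, and for $u\in\mathbb R^m$ put $$h_P(u)=\inf\Big\{\sum_{i=1}^n f_i(x_i): Ax-b\le u\Big\},\qquad h_{CoP}(u)=\inf\Big\{\sum_{i=1}^n f_i^{**}(x_i): Ax-b\le u\Big\}.$$ Assume $h_{CoP}(0)<+\infty$. Let $$\rho_k(f_i)=\sup\Big\{f_i\Big(\sum_{j=1}^{d_i+1}\alpha_jx_j\Big)-\sum_{j=1}^{d_i+1}\alpha_jf_i(x_j):\ x_j\in\operatorname{dom} f_i,\ \alpha\ge0,\ \mathbf 1^\top\alpha=1,\ \operatorname{Card}(\alpha)\le k\Big\}$$ and $\mathcal F_i=\{(f_i^{**}(x),A_ix): x\in\operatorname{dom} f_i^{**}\}\subset\mathbb R^{m+1}$;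 call $(f_i^{**}(x),A_ix)$ with $f_i(x)=f_i^{**}(x)<+\infty$ a contact point of $\mathcal F_i$. Let $\mathcal G_r^{**}$ be the closed convex hull of $\{(r_0,r)\in\mathbb R^{1+m}:\ \exists x,\ \sum_if_i(x_i)\le r_0,\ Ax-b\le r\}$ and $\Psi(\lambda)=\inf\{r_0+\lambda^\top r:(r_0,r)\in\mathcal G_r^{**}\}$ the Lagrange dual function. Consider $x^\star\in\mathbb R^d$ feasible for $Ax\le b$ with $\sum_if_i^{**}(x_i^\star)=h_{CoP}(0)$, a vector $w\in\mathbb R^m_+$, weights $\lambda_{ij}\ge0$ with $\sum_{j=1}^{m+2}\lambda_{ij}=1$ for each $i$, at most $n+m+1$ of them nonzero, and contact points $z_{ij}$ of $\mathcal F_i$, such that $$z^\star=\sum_{i=1}^n\begin{pmatrix}f_i^{**}(x_i^\star)\\A_ix_i^\star\end{pmatrix}+\begin{pmatrix}0\\w-b\end{pmatrix}=\sum_{i=1}^n\sum_{j=1}^{m+2}\lambda_{ij}z_{ij}+\begin{pmatrix}0\\w-b\end{pmatrix}$$ lies in $\mathcal G_r^{**}$ and attains the infimum defining $\Psi(\lambda)$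 for every $\lambda\geq 0$ that maximizes $\Psi$ over $\mathbb R^m_+$. Put $$R_v=\max_{ij:\lambda_{ij}\ne1}\|\lambda_{ij}z_{ij}\|_2,\quad R_\lambda=\max_{ij:\lambda_{ij}\ne1}|\lambda_{ij}|,\quad M_V=\sup_{\|a\|_2\le1,\ v_i\in\mathcal F_i}\Big\|\sum_ia_iv_i\Big\|_2\in[0,+\infty]$$ (a maximum over the empty set is $0$, and $0\cdot\infty=0$). For $s\in\mathbb R$, an $s$-sparse error is a vector $u=(u_1,u_2)\in\mathbb R\times\mathbb R^m$ of the form $u=\sum_{i,j}\mu_{ij}y_{ij}+(0,w-b)-z^\star$ with contact points $y_{ij}$ of $\mathcal F_i$ ($1\le i\le n$, $1\le j\le m+2$), $\mu_{ij}\ge0$, $\sum_j\mu_{ij}=1$, and at most $s$ nonzero $\mu_{ij}$. **Claim.** There is an absolute constant $c>0$ such that for all data as above: such $x^\star,w,\lambda_{ij},z_{ij}$ exist; and for every such choice and every $\gamma>0$, with $$s=n+1+2m\,\frac{c}{\gamma^2+c},$$ there is an $s$-sparse error $u=(u_1,u_2)$ with $$h_{CoP}(u_2)\le h_P(u_2)\le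 h_{CoP}(0)+|u_1|+\max\Big\{\sum_{i=1}^n\rho_{\beta_i}(f_i):\ \beta_i\in\{1,\dots,m+2\},\ \sum_{i=1}^n\beta_i\le s\Big\}$$ and $$\max\{|u_1|,\|u_2\|_2\}\le\sqrt{2m}\,(R_v+R_\lambda M_V)\,\gamma .$$ Moreover these two bounds hold for every $s$-sparse error $u$ of minimal Euclidean norm. -/

import Mathlib

open scoped BigOperators

noncomputable section

/-- Euclidean space of dimension `d`. -/
abbrev Euc (d : ℕ) : Type := EuclideanSpace ℝ (Fin d)

/-- The space of pairs (objective value, constraint values), of dimension `m + 1`, with its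
Euclidean norm. -/
abbrev EpiSpace (m : ℕ) : Type := WithLp 2 (ℝ × EuclideanSpace ℝ (Fin m))

/-- The Fenchel conjugate of an extended-real-valued function. -/
def fenchelConj {d : ℕ} (f : Euc d → EReal) (y : Euc d) : EReal :=
  ⨆ x : Euc d, ((inner ℝ y x : ℝ) : EReal) - f x

/-- The biconjugate (convex envelope). -/
def biconj {d : ℕ} (f : Euc d → EReal) : Euc d → EReal := fenchelConj (fenchelConj f)

/-- Proper, 1-coercive (`f x / ‖x‖ → +∞` as `‖x‖ → +∞`), lower semicontinuous, and minorized by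
an affine function. -/
structure GoodFunction {d : ℕ} (f : Euc d → EReal) : Prop where
  ne_bot : ∀ x, f x ≠ ⊥
  exists_lt_top : ∃ x, f x < ⊤
  coercive : ∀ M : ℝ, ∀ᶠ x in Bornology.cobounded (Euc d), ((M * ‖x‖ : ℝ) : EReal) ≤ f x
  lsc : LowerSemicontinuous f
  affine_minorant : ∃ (y : Euc d) (r : ℝ), ∀ x, ((inner ℝ y x + r : ℝ) : EReal) ≤ f x

/-- The `k`-th nonconvexity measure: the largest value of `f (∑ αⱼ xⱼ) - ∑ αⱼ f (xⱼ)` over `d + 1`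
points of the domain of `f` and convex weights with at most `k` nonzero entries. The barycentre is
not required to lie in the domain: the measure is `⊤` if it can leave it. -/
def rhoK {d : ℕ} (f : Euc d → EReal) (k : ℕ) : EReal :=
  ⨆ (x : Fin (d + 1) → Euc d) (α : Fin (d + 1) → ℝ)
    (_ : (∀ j, f (x j) < ⊤) ∧ (∀ j, 0 ≤ α j) ∧ ∑ j, α j = 1 ∧
      (Finset.univ.filter fun j => α j ≠ 0).card ≤ k),
    f (∑ j, α j • x j) - ∑ j, (α j : EReal) * f (x j)

/-- The data of a separable problem: minimize `∑ i, f i (x i)` subject to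
`∑ i, A i (x i) ≤ b` (`m` inequalities). The constraints `x i ∈ Y i` are absorbed in the
extended-real-valued `f i`; `A i` is the `i`-th column block of the constraint matrix. -/
structure SepProblem (n m : ℕ) where
  d : Fin n → ℕ
  f : (i : Fin n) → Euc (d i) → EReal
  A : (i : Fin n) → Matrix (Fin m) (Fin (d i)) ℝ
  b : Euc m

namespace SepProblem

variable {n m : ℕ} (P : SepProblem n m)

/-- The variable of the problem, in blocks. -/
abbrev Var : Type := (i : Fin n) → Euc (P.d i)

/-- `A i x`, as a Euclidean vector. -/
def block (i : Fin n) (x : Euc (P.d i)) : Euc m :=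
  WithLp.toLp 2 ((P.A i).mulVec (WithLp.ofLp x))

/-- `A x = ∑ i, A i (x i)`. -/
def mulA (x : P.Var) : Euc m := ∑ i, P.block i (x i)

/-- Feasibility for the perturbed constraint `A x - b ≤ u`. -/
def Feasible (u : Euc m) (x : P.Var) : Prop := ∀ k, (P.mulA x - P.b) k ≤ u k

/-- Optimal value of the perturbed nonconvex problem. -/
def hP (u : Euc m) : EReal :=
  ⨅ (x : P.Var) (_ : P.Feasible u x), ∑ i, P.f i (x i)

/-- Optimal value of the perturbed convex relaxation. -/
def hCoP (u : Euc m) : EReal :=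
  ⨅ (x : P.Var) (_ : P.Feasible u x), ∑ i, biconj (P.f i) (x i)

/-- `x` attains the (finite) optimal value of the unperturbed convex relaxation. -/
def IsRelaxedOptimal (x : P.Var) : Prop :=
  P.Feasible 0 x ∧ (∀ i, biconj (P.f i) (x i) < ⊤) ∧
    ∑ i, biconj (P.f i) (x i) = P.hCoP 0

/-- The projected epigraph of the nonconvex problem. -/
def epiG : Set (EpiSpace m) :=
  {r | ∃ x : P.Var, ∑ i, P.f i (x i) ≤ (r.fst : EReal) ∧ P.Feasible r.snd x}

/-- Its closed convex hull. -/
def epiGHull : Set (EpiSpace m) := closure (convexHull ℝ P.epiG)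

/-- The Lagrange dual function. -/
def dualFun (l : Euc m) : EReal :=
  ⨅ r ∈ P.epiGHull, ((r.fst + inner ℝ l r.snd : ℝ) : EReal)

/-- `l` is an optimal solution of the dual problem: maximize the dual function over `l ≥ 0`. -/
def IsDualOptimal (l : Euc m) : Prop :=
  (∀ k, 0 ≤ l k) ∧ ∀ l' : Euc m, (∀ k, 0 ≤ l' k) → P.dualFun l' ≤ P.dualFun l

/-- `r` lies in the closed convex hull of the epigraph and attains the infimum that defines the
dual function at the optimal dual variables. -/
def IsDualMinimizer (r : EpiSpace m) : Prop :=
  r ∈ P.epiGHull ∧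
    ∀ l, P.IsDualOptimal l → ((r.fst + inner ℝ l r.snd : ℝ) : EReal) = P.dualFun l

/-- The set `𝓕ᵢ` of all `(fᵢ** (x), Aᵢ x)` with `fᵢ** (x)` finite. -/
def setF (i : Fin n) : Set (EpiSpace m) :=
  {r | ∃ x, (r.fst : EReal) = biconj (P.f i) x ∧ r.snd = P.block i x}

/-- The points of `𝓕ᵢ` that come from a point `x` with `fᵢ (x) = fᵢ** (x)`. -/
def contactF (i : Fin n) : Set (EpiSpace m) :=
  {r | ∃ x, (r.fst : EReal) = biconj (P.f i) x ∧ P.f i x = biconj (P.f i) x ∧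
    r.snd = P.block i x}

/-- `∑ i, (fᵢ** (xᵢ), Aᵢ xᵢ)`, for `x` with all `fᵢ** (xᵢ)` finite. -/
def sumPoint (x : P.Var) : EpiSpace m :=
  ∑ i, WithLp.toLp 2 ((biconj (P.f i) (x i)).toReal, P.block i (x i))

/-- The point `z* = ∑ i, (fᵢ** (xᵢ), Aᵢ xᵢ) + (0, w - b)`. -/
def zStar (x : P.Var) (w : Euc m) : EpiSpace m :=
  P.sumPoint x + WithLp.toLp 2 ((0 : ℝ), w - P.b)

/-- Convex weights `lam i ·` on `m + 2` points `z i ·`, for each `i`; the points lie in `𝓕ᵢ` and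
come from points where `fᵢ` agrees with its convex envelope. -/
def IsCombination (lam : Fin n → Fin (m + 2) → ℝ) (z : Fin n → Fin (m + 2) → EpiSpace m) : Prop :=
  (∀ i j, 0 ≤ lam i j) ∧ (∀ i, ∑ j, lam i j = 1) ∧ ∀ i j, z i j ∈ P.contactF i

/-- Total number of nonzero coefficients. -/
def numNonzero (lam : Fin n → Fin (m + 2) → ℝ) : ℕ :=
  ∑ i, (Finset.univ.filter fun j => lam i j ≠ 0).card

/-- `x` is optimal for the convex relaxation, `w ≥ 0`, the point `z*` formed with `x` and `w`
is a minimizer in the dual function, and `lam`, `z` represent it: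
`z* = ∑ i, ∑ j, lam i j • z i j + (0, w - b)`, with at most `n + m + 1` nonzero coefficients. -/
def IsOptimalRepresentation (x : P.Var) (w : Euc m) (lam : Fin n → Fin (m + 2) → ℝ)
    (z : Fin n → Fin (m + 2) → EpiSpace m) : Prop :=
  P.IsRelaxedOptimal x ∧ (∀ k, 0 ≤ w k) ∧ P.IsDualMinimizer (P.zStar x w) ∧
    P.IsCombination lam z ∧
    P.zStar x w = ∑ i, ∑ j, lam i j • z i j + WithLp.toLp 2 ((0 : ℝ), w - P.b) ∧
    numNonzero lam ≤ n + m + 1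

/-- `u` is the error `∑ i, ∑ j, mu i j • y i j + (0, w - b) - z*` of an approximation of `z*` that
uses at most `s` nonzero coefficients. -/
def IsSparseError (zs : EpiSpace m) (w : Euc m) (s : ℝ) (u : EpiSpace m) : Prop :=
  ∃ (mu : Fin n → Fin (m + 2) → ℝ) (y : Fin n → Fin (m + 2) → EpiSpace m),
    P.IsCombination mu y ∧ (numNonzero mu : ℝ) ≤ s ∧
    u = ∑ i, ∑ j, mu i j • y i j + WithLp.toLp 2 ((0 : ℝ), w - P.b) - zs

/-- `max {∑ i, ρ_{βᵢ} (fᵢ) : βᵢ ∈ [1, m + 2], ∑ i, βᵢ ≤ s}`, over integers `βᵢ`. -/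
def maxRho (s : ℝ) : EReal :=
  ⨆ (β : Fin n → ℕ) (_ : (∀ i, 1 ≤ β i ∧ β i ≤ m + 2) ∧ ((∑ i, β i : ℕ) : ℝ) ≤ s),
    ∑ i, rhoK (P.f i) (β i)

/-- `max ‖lam i j • z i j‖` over `lam i j ≠ 1` (zero if there is no such pair). -/
def radiusV (lam : Fin n → Fin (m + 2) → ℝ) (z : Fin n → Fin (m + 2) → EpiSpace m) : ENNReal :=
  ⨆ (i : Fin n) (j : Fin (m + 2)) (_ : lam i j ≠ 1), ‖lam i j • z i j‖ₑ

/-- `max |lam i j|` over `lam i j ≠ 1` (zero if there is no such pair). -/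
def radiusLam (lam : Fin n → Fin (m + 2) → ℝ) : ENNReal :=
  ⨆ (i : Fin n) (j : Fin (m + 2)) (_ : lam i j ≠ 1), ‖lam i j‖ₑ

/-- `sup ‖∑ i, a i • v i‖` over `‖a‖ ≤ 1` and `v i ∈ 𝓕ᵢ`, possibly infinite. -/
def MV : ENNReal :=
  ⨆ (a : Euc n) (_ : ‖a‖ ≤ 1) (v : Fin n → EpiSpace m) (_ : ∀ i, v i ∈ P.setF i),
    ‖∑ i, a i • v i‖ₑ

/-- The duality gap bound for the perturbation `u = (u₁, u₂)` and sparsity `s`. -/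
def GapBound (s : ℝ) (u : EpiSpace m) : Prop :=
  P.hCoP u.snd ≤ P.hP u.snd ∧
    P.hP u.snd ≤ P.hCoP 0 + (((|u.fst| : ℝ) : EReal) + P.maxRho s)

end SepProblem

end

/-
Duality for the convex relaxation shows that `z*` built from a relaxed optimum and `w = 0` minimizes
the Lagrangian at every optimal multiplier. Each `(fᵢ** (xᵢ), Aᵢ xᵢ)` is a convex combination of
contact points, and the Shapley–Folkman argument cuts the total support down to `n + m + 1`.

To sparsify further, keep the blocks whose weight sits on a single point and replace each of the
`p ≤ m + 1` others by the empirical average of `q` of its own points. By Maurey's probabilistic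
argument the squared error can be kept below `V / q`, where `V` is the sum of the second moments.
If these blocks carry `N ≤ 2 (m + 1)` nonzero weights then `p ≤ N R_λ` and `V ≤ N R_v M_V`, so AM-GM
gives `4 p V ≤ N² (R_v + R_λ M_V)²`. Rounding `q` costs a factor `2`, for which `c = 4` leaves room.

A block with `k` nonzero weights loses at most `ρ_k (fᵢ)` when its combination is moved inside `fᵢ`,
and the error `u` is absorbed into the right-hand side of the constraint.
-/

open scoped Finset

theorem sum_smul_comp_of_fiberwise_sum {R ι κ V : Type*} [Fintype ι] [Fintype κ] [DecidableEq ι]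
    [Semiring R] [AddCommMonoid V] [Module R V] {g : κ → ι} {w' : κ → R} {w : ι → R}
    (h : ∀ i, ∑ j with g j = i, w' j = w i) (v : ι → V) :
    ∑ j, w' j • v (g j) = ∑ i, w i • v i := by
  simp_rw [← h, Finset.sum_smul]
  rw [← Finset.sum_fiberwise Finset.univ g]
  refine Finset.sum_congr rfl fun i _ => Finset.sum_congr rfl fun j hj => ?_
  rw [(Finset.mem_filter_univ j).1 hj]

theorem exists_reindex_fiberwise_sum {M ι κ : Type*} [AddCommMonoid M] [DecidableEq M]
    [Fintype ι] [Fintype κ] [Nonempty ι] [DecidableEq ι] {w : ι → M}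
    (h : #{i | w i ≠ 0} ≤ Fintype.card κ) :
    ∃ (g : κ → ι) (w' : κ → M), (∀ j, w' j = 0 ∨ w' j = w (g j)) ∧
      #{j | w' j ≠ 0} = #{i | w i ≠ 0} ∧ ∀ i, ∑ j with g j = i, w' j = w i := by
  obtain ⟨e⟩ : Nonempty ({i // w i ≠ 0} ↪ κ) :=
    Function.Embedding.nonempty_of_card_le (by rwa [Fintype.card_subtype])
  let g : κ → ι := Function.extend e Subtype.val fun _ => Classical.arbitrary ι
  let w' : κ → M := Function.extend e (fun i => w i) 0
  have hg (i) : g (e i) = i := e.injective.extend_apply _ _ _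
  have hw' (i) : w' (e i) = w i := e.injective.extend_apply _ _ _
  have hrange (j) (hj : w' j ≠ 0) : ∃ i, e i = j := by
    by_contra hne
    exact hj (Function.extend_apply' _ _ _ hne)
  have hzero (j) : w' j = 0 ∨ w' j = w (g j) := by
    by_cases hj : w' j = 0
    · exact Or.inl hj
    · obtain ⟨i, rfl⟩ := hrange j hj
      exact Or.inr (by rw [hw', hg])
  refine ⟨g, w', hzero, ?_, fun i => ?_⟩
  · have : ({j | w' j ≠ 0} : Finset κ) = Finset.univ.map e := by
      ext j
      simp only [Finset.mem_filter_univ, Finset.mem_map, Finset.mem_univ, true_and]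
      exact ⟨hrange j, by rintro ⟨i, rfl⟩; exact (hw' i).trans_ne i.2⟩
    rw [this, Finset.card_map, Finset.card_univ, Fintype.card_subtype]
  · by_cases hi : w i = 0
    · rw [hi]
      refine Finset.sum_eq_zero fun j hj => ?_
      rw [Finset.mem_filter_univ] at hj
      exact (hzero j).elim id fun h => by rw [h, hj, hi]
    · rw [Finset.sum_eq_single_of_mem (e ⟨i, hi⟩) (by simp [hg]), hw']
      refine fun j hj hne => of_not_not fun hj' => hne ?_
      obtain ⟨i', rfl⟩ := hrange j hj'
      simp only [Finset.mem_filter_univ, hg] at hj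
      exact congrArg e (Subtype.ext hj)

theorem exists_nonneg_add_mul_eq_zero {𝕜 ι : Type*} [Field 𝕜] [LinearOrder 𝕜]
    [IsStrictOrderedRing 𝕜] [Finite ι] {w δ : ι → 𝕜} (hw : ∀ i, 0 ≤ w i) (hδ : ∃ i, δ i < 0) :
    ∃ t, 0 ≤ t ∧ (∀ i, 0 ≤ w i + t * δ i) ∧ ∃ i, δ i < 0 ∧ w i + t * δ i = 0 := by
  obtain ⟨i₀, hi₀ : δ i₀ < 0, hmin⟩ :=
    Set.exists_min_image {i | δ i < 0} (fun i => w i / -δ i) (Set.toFinite _) hδ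
  have ht : 0 ≤ w i₀ / -δ i₀ := div_nonneg (hw i₀) (neg_nonneg.2 hi₀.le)
  refine ⟨w i₀ / -δ i₀, ht, fun i => ?_, i₀, hi₀, by field_simp [hi₀.ne]; simp⟩
  rcases lt_or_ge (δ i) 0 with hi | hi
  · have hratio := (le_div_iff₀ (neg_pos.2 hi)).1 (hmin i hi)
    linarith
  · exact add_nonneg (hw i) (mul_nonneg ht hi)

section BasicSolutions

variable {𝕜 ι κ V : Type*} [Field 𝕜] [LinearOrder 𝕜] [IsStrictOrderedRing 𝕜] [Fintype ι] [Fintype κ]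
  [AddCommGroup V] [Module 𝕜 V]

theorem exists_dependency_of_finrank_lt_card [FiniteDimensional 𝕜 V] (v : ι → V) (c : ι → 𝕜)
    {s : Finset ι} (hs : Module.finrank 𝕜 V < #s) :
    ∃ δ : ι → 𝕜, δ ≠ 0 ∧ (∀ i ∉ s, δ i = 0) ∧ ∑ i, δ i • v i = 0 ∧ ∑ i, δ i * c i ≤ 0 := by
  classical
  have hdep : ¬ LinearIndepOn 𝕜 v (s : Set ι) := fun h =>
    hs.not_ge (by simpa using LinearIndependent.fintype_card_le_finrank h)
  obtain ⟨g, hg, i, hi, hgi⟩ := not_linearIndepOn_finset_iff.1 hdep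
  let δ : ι → 𝕜 := fun j => if j ∈ s then g j else 0
  have hδs : ∀ j ∉ s, δ j = 0 := fun j hj => if_neg hj
  have hδi : δ i ≠ 0 := by rwa [show δ i = g i from if_pos hi]
  have hδ : ∑ j, δ j • v j = 0 := by
    rw [← hg, ← Finset.sum_subset s.subset_univ fun j _ hj => by rw [hδs j hj, zero_smul]]
    exact Finset.sum_congr rfl fun j hj => by rw [show δ j = g j from if_pos hj]
  rcases le_total (∑ j, δ j * c j) 0 with hcost | hcost
  · exact ⟨δ, fun h => hδi (congrFun h i), hδs, hδ, hcost⟩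
  · refine ⟨-δ, fun h => hδi (congrFun (neg_eq_zero.1 h) i), fun j hj => ?_, ?_, ?_⟩
    · rw [Pi.neg_apply, hδs j hj, neg_zero]
    · simpa using hδ
    · simpa using hcost

theorem exists_basic_solution [FiniteDimensional 𝕜 V] (v : ι → V) (c : ι → 𝕜) {φ : V →ₗ[𝕜] 𝕜}
    (hφ : ∀ i, 0 < φ (v i)) {w : ι → 𝕜} (hw : ∀ i, 0 ≤ w i) :
    ∃ w' : ι → 𝕜, (∀ i, 0 ≤ w' i) ∧ (∀ i, w i = 0 → w' i = 0) ∧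
      ∑ i, w' i • v i = ∑ i, w i • v i ∧ ∑ i, w' i * c i ≤ ∑ i, w i * c i ∧
      #{i | w' i ≠ 0} ≤ Module.finrank 𝕜 V := by
  obtain ⟨w', ⟨hw', hsupp, hsum, hcost⟩, hmin⟩ := exists_minimalFor_of_wellFoundedLT
    (fun w' : ι → 𝕜 => (∀ i, 0 ≤ w' i) ∧ (∀ i, w i = 0 → w' i = 0) ∧
      ∑ i, w' i • v i = ∑ i, w i • v i ∧ ∑ i, w' i * c i ≤ ∑ i, w i * c i)
    (fun w' => #{i | w' i ≠ 0}) ⟨w, hw, fun _ h => h, rfl, le_rfl⟩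
  refine ⟨w', hw', hsupp, hsum, hcost, ?_⟩
  by_contra! hcard
  obtain ⟨δ, hδ, hδsupp, hδsum, hδcost⟩ := exists_dependency_of_finrank_lt_card v c hcard
  replace hδsupp : ∀ i, w' i = 0 → δ i = 0 := fun i hi => hδsupp i (by simpa using hi)
  have hneg : ∃ i, δ i < 0 := by
    by_contra! hnonneg
    have hφsum : ∑ i, δ i * φ (v i) = 0 := by simpa using congrArg φ hδsum
    refine hδ (funext fun i => ?_)
    have := (Finset.sum_eq_zero_iff_of_nonneg fun i _ =>
      mul_nonneg (hnonneg i) (hφ i).le).1 hφsum i (Finset.mem_univ i)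
    exact (mul_eq_zero.1 this).resolve_right (hφ i).ne'
  obtain ⟨t, ht, hnonneg, i₀, hi₀, hzero⟩ := exists_nonneg_add_mul_eq_zero hw' hneg
  have hlt : #{i | w' i + t * δ i ≠ 0} < #{i | w' i ≠ 0} := by
    refine Finset.card_lt_card (Finset.ssubset_iff_of_subset ?_ |>.2 ⟨i₀, ?_, ?_⟩)
    · refine Finset.monotone_filter_right _ fun i _ hi hi' => hi ?_
      rw [hi', hδsupp i hi', mul_zero, add_zero]
    · simpa using fun h => hi₀.ne (hδsupp i₀ h)
    · simpa using hzero
  refine hlt.not_ge (hmin ⟨hnonneg, fun i hi => ?_, ?_, ?_⟩ hlt.le)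
  · simp only [hsupp i hi, hδsupp i (hsupp i hi), mul_zero, add_zero]
  · simp only [add_smul, mul_smul, Finset.sum_add_distrib, ← Finset.smul_sum, hδsum, smul_zero,
      add_zero, hsum]
  · simp only [add_mul, mul_assoc, Finset.sum_add_distrib, ← Finset.mul_sum]
    linarith [mul_nonpos_of_nonneg_of_nonpos ht hδcost]

theorem exists_caratheodory_le [FiniteDimensional 𝕜 V] (hκ : Module.finrank 𝕜 V < Fintype.card κ)
    (v : ι → V) (c : ι → 𝕜) {w : ι → 𝕜} (hw : ∀ i, 0 ≤ w i) (hw1 : ∑ i, w i = 1) :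
    ∃ (g : κ → ι) (α : κ → 𝕜), (∀ j, 0 ≤ α j) ∧ ∑ j, α j = 1 ∧
      ∑ j, α j • v (g j) = ∑ i, w i • v i ∧ ∑ j, α j * c (g j) ≤ ∑ i, w i * c i ∧
      #{j | α j ≠ 0} ≤ #{i | w i ≠ 0} := by
  classical
  obtain ⟨w', hw', hsupp, hsum, hcost, hcard⟩ := exists_basic_solution
    (fun i => (v i, (1 : 𝕜))) c (φ := LinearMap.snd 𝕜 V 𝕜) (fun _ => one_pos) hw
  simp only [Prod.smul_mk, Prod.ext_iff, Prod.fst_sum, Prod.snd_sum, smul_eq_mul, mul_one, hw1]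
    at hsum
  have : Nonempty ι := by
    by_contra hne
    rw [not_nonempty_iff] at hne
    simp at hw1
  obtain ⟨g, α, hα, hαcard, hfib⟩ := exists_reindex_fiberwise_sum (κ := κ) (w := w')
    (hcard.trans (by simpa using hκ))
  refine ⟨g, α, fun j => ?_, ?_, ?_, ?_, hαcard.trans_le (Finset.card_le_card ?_)⟩
  · rcases hα j with h | h <;> simp only [h, le_refl, hw']
  · rw [← hsum.2]
    simpa using sum_smul_comp_of_fiberwise_sum hfib fun _ => (1 : 𝕜)
  · rw [sum_smul_comp_of_fiberwise_sum hfib, hsum.1]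
  · exact (sum_smul_comp_of_fiberwise_sum hfib c).trans_le hcost
  · exact Finset.monotone_filter_right _ fun i _ hi h => hi (hsupp i h)

theorem mem_convexHull_iff_exists_of_finrank_lt [FiniteDimensional 𝕜 V]
    (hκ : Module.finrank 𝕜 V < Fintype.card κ) {s : Set V} {x : V} :
    x ∈ convexHull 𝕜 s ↔ ∃ (α : κ → 𝕜) (z : κ → V), (∀ j, 0 ≤ α j) ∧ ∑ j, α j = 1 ∧
      (∀ j, z j ∈ s) ∧ ∑ j, α j • z j = x := by
  refine ⟨fun hx => ?_, fun ⟨α, z, hα, hα1, hz, hx⟩ =>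
    mem_convexHull_of_exists_fintype α z hα hα1 hz hx⟩
  obtain ⟨J, _, w, z, hw, hw1, hz, rfl⟩ := mem_convexHull_iff_exists_fintype.1 hx
  obtain ⟨g, α, hα, hα1, hsum, -, -⟩ := exists_caratheodory_le hκ z 0 hw hw1
  exact ⟨α, z ∘ g, hα, hα1, fun j => hz _, hsum⟩

theorem shapley_folkman [FiniteDimensional 𝕜 V] (hκ : Module.finrank 𝕜 V < Fintype.card κ)
    {S : ι → Set V} {x : ι → V} (hx : ∀ i, x i ∈ convexHull 𝕜 (S i)) :
    ∃ (α : ι → κ → 𝕜) (z : ι → κ → V), (∀ i j, 0 ≤ α i j) ∧ (∀ i, ∑ j, α i j = 1) ∧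
      (∀ i j, z i j ∈ S i) ∧ ∑ i, ∑ j, α i j • z i j = ∑ i, x i ∧
      ∑ i, #{j | α i j ≠ 0} ≤ Fintype.card ι + Module.finrank 𝕜 V := by
  classical
  choose w z hw hw1 hz hwz using fun i => (mem_convexHull_iff_exists_of_finrank_lt hκ).1 (hx i)
  obtain ⟨w', hw', -, hsum, -, hcard⟩ := exists_basic_solution
    (fun p : ι × κ => (z p.1 p.2, (Pi.single p.1 1 : ι → 𝕜))) 0
    (φ := ∑ i, LinearMap.proj i ∘ₗ LinearMap.snd 𝕜 V (ι → 𝕜)) (by simp) (w := fun p => w p.1 p.2)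
    fun p => hw p.1 p.2
  simp only [Prod.smul_mk, Prod.ext_iff, Prod.fst_sum, Prod.snd_sum, Fintype.sum_prod_type, hwz,
    funext_iff, Finset.sum_apply, Pi.smul_apply, Pi.single_apply, smul_eq_mul, mul_ite, mul_one,
    mul_zero] at hsum
  refine ⟨fun i j => w' (i, j), z, fun i j => hw' _, fun i => ?_, hz, hsum.1, ?_⟩
  · have := hsum.2 i
    rw [Finset.sum_comm, Finset.sum_comm (s := Finset.univ (α := ι))] at this
    simpa [hw1] using this
  · refine (le_of_eq ?_).trans (hcard.trans_eq ?_)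
    · simp only [Finset.card_filter, Fintype.sum_prod_type]
    · rw [Module.finrank_prod, Module.finrank_fintype_fun_eq_card, add_comm]

end BasicSolutions

theorem isCompact_convexHull_of_finiteDimensional {V : Type*} [AddCommGroup V] [Module ℝ V]
    [FiniteDimensional ℝ V] [TopologicalSpace V] [ContinuousAdd V] [ContinuousSMul ℝ V] {B : Set V}
    (hB : IsCompact B) : IsCompact (convexHull ℝ B) := by
  let κ := Fin (Module.finrank ℝ V + 1)
  have himage : convexHull ℝ B = (fun p : (κ → ℝ) × (κ → V) => ∑ j, p.1 j • p.2 j) ''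
      stdSimplex ℝ κ ×ˢ Set.univ.pi fun _ => B := by
    ext x
    rw [mem_convexHull_iff_exists_of_finrank_lt (κ := κ) (by simp [κ])]
    simp only [Set.mem_image, Set.mem_prod, Set.mem_univ_pi, Prod.exists, stdSimplex,
      Set.mem_ofPred_eq, and_assoc]
  rw [himage]
  exact ((isCompact_stdSimplex ℝ κ).prod (isCompact_univ_pi fun _ => hB)).image (by fun_prop)
section ConvexHullOfEpigraph

variable {V : Type*} [NormedAddCommGroup V] [NormedSpace ℝ V] {E : Set (V × ℝ)}

/-- The cone spanned by `{1} × E` together with the vertical rays `(0, 0, t)`, `t ≥ 0`. For the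
epigraph `E` of a 1-coercive lower semicontinuous function this is a closed cone, whose slice at
height `1` is the epigraph. -/
def epiCone (E : Set (V × ℝ)) : Set (ℝ × V × ℝ) :=
  {k | (0 < k.1 ∧ k.1⁻¹ • k.2 ∈ E) ∨ (k.1 = 0 ∧ k.2.1 = 0 ∧ 0 ≤ k.2.2)}

theorem epiCone_mono {E' : Set (V × ℝ)} (h : E ⊆ E') : epiCone E ⊆ epiCone E' :=
  fun _ hk => hk.imp_left fun hk => ⟨hk.1, h hk.2⟩

theorem mem_epiCone_of_mem {p : V × ℝ} (hp : p ∈ E) : ((1 : ℝ), p) ∈ epiCone E :=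
  Or.inl ⟨one_pos, by simpa using hp⟩

theorem fst_nonneg_of_mem_epiCone {k : ℝ × V × ℝ} (hk : k ∈ epiCone E) : 0 ≤ k.1 :=
  hk.elim (fun h => h.1.le) fun h => h.1.ge

theorem smul_mem_epiCone {k : ℝ × V × ℝ} (hk : k ∈ epiCone E) {a : ℝ} (ha : 0 < a) :
    a • k ∈ epiCone E := by
  rcases hk with ⟨hpos, hmem⟩ | ⟨hzero, hzero', hnonneg⟩
  · refine Or.inl ⟨mul_pos ha hpos, ?_⟩
    rwa [Prod.smul_fst, Prod.smul_snd, smul_eq_mul, smul_smul, mul_inv_rev,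
      inv_mul_cancel_right₀ ha.ne']
  · exact Or.inr ⟨by simp [hzero], by simp [hzero'], mul_nonneg ha.le hnonneg⟩

theorem add_mem_epiCone (hconv : Convex ℝ E) (hup : ∀ p ∈ E, ∀ r : ℝ, 0 ≤ r → p + (0, r) ∈ E)
    {k l : ℝ × V × ℝ} (hk : k ∈ epiCone E) (hl : l ∈ epiCone E) : k + l ∈ epiCone E := by
  have add_vertical {k l : ℝ × V × ℝ} (hk : 0 < k.1 ∧ k.1⁻¹ • k.2 ∈ E)
      (hl : l.1 = 0 ∧ l.2.1 = 0 ∧ 0 ≤ l.2.2) : k + l ∈ epiCone E := by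
    obtain ⟨_, _, τ⟩ := l
    obtain ⟨rfl, rfl, hτ⟩ := hl
    refine Or.inl ⟨by simpa using hk.1, ?_⟩
    simpa [smul_add] using hup _ hk.2 (k.1⁻¹ * τ) (mul_nonneg (inv_nonneg.2 hk.1.le) hτ)
  rcases hk with hk | hk <;> rcases hl with hl | hl
  · have hpos : 0 < k.1 + l.1 := add_pos hk.1 hl.1
    have hmem := hconv hk.2 hl.2 (div_nonneg hk.1.le hpos.le) (div_nonneg hl.1.le hpos.le)
      (by field_simp)
    refine Or.inl ⟨hpos, ?_⟩
    convert hmem using 1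
    rw [Prod.snd_add, Prod.fst_add, smul_smul, smul_smul, smul_add, div_mul_eq_mul_div,
      mul_inv_cancel₀ hk.1.ne', div_mul_eq_mul_div, mul_inv_cancel₀ hl.1.ne', one_div]
  · exact add_vertical hk hl
  · rw [add_comm]
    exact add_vertical hl hk
  · exact Or.inr ⟨by simp [hk.1, hl.1], by simp [hk.2.1, hl.2.1], add_nonneg hk.2.2 hl.2.2⟩

theorem convex_epiCone (hconv : Convex ℝ E) (hup : ∀ p ∈ E, ∀ r : ℝ, 0 ≤ r → p + (0, r) ∈ E) :
    Convex ℝ (epiCone E) :=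
  convex_iff_forall_pos.2 fun _ hk _ hl _ _ ha hb _ =>
    add_mem_epiCone hconv hup (smul_mem_epiCone hk ha) (smul_mem_epiCone hl hb)

theorem le_of_mem_epiCone {M C : ℝ} (hC : ∀ p ∈ E, M * ‖p.1‖ - C ≤ p.2) {k : ℝ × V × ℝ}
    (hk : k ∈ epiCone E) : M * ‖k.2.1‖ - C * k.1 ≤ k.2.2 := by
  rcases hk with ⟨hpos, hmem⟩ | ⟨hzero, hzero', hnonneg⟩
  · have h := hC _ hmem
    rw [Prod.smul_fst, Prod.smul_snd, norm_smul, norm_inv, Real.norm_of_nonneg hpos.le,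
      smul_eq_mul] at h
    field_simp at h
    linarith
  · simpa [hzero, hzero'] using hnonneg

theorem isClosed_epiCone (hclosed : IsClosed E)
    (hsuper : ∀ M : ℝ, ∃ C, ∀ p ∈ E, M * ‖p.1‖ - C ≤ p.2) : IsClosed (epiCone E) := by
  refine isClosed_of_closure_subset fun k hk => ?_
  obtain ⟨u, hu, hlim⟩ := mem_closure_iff_seq_limit.1 hk
  have hlim₁ := hlim.fst_nhds
  have hlim₂ := hlim.snd_nhds
  have hnonneg : 0 ≤ k.1 := ge_of_tendsto' hlim₁ fun n => fst_nonneg_of_mem_epiCone (hu n)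
  rcases hnonneg.eq_or_lt with hzero | hpos
  · have hbound (M : ℝ) : M * ‖k.2.1‖ ≤ k.2.2 := by
      obtain ⟨C, hC⟩ := hsuper M
      have := le_of_tendsto_of_tendsto' ((hlim₂.fst_nhds.norm.const_mul M).sub
        (hlim₁.const_mul C)) hlim₂.snd_nhds fun n => le_of_mem_epiCone hC (hu n)
      simpa [← hzero] using this
    refine Or.inr ⟨hzero.symm, ?_, by simpa using hbound 0⟩
    by_contra hne
    have := hbound ((k.2.2 + 1) / ‖k.2.1‖)
    rw [div_mul_cancel₀ _ (norm_ne_zero_iff.2 hne)] at this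
    linarith
  · refine Or.inl ⟨hpos, hclosed.mem_of_tendsto ((hlim₁.inv₀ hpos.ne').smul hlim₂) ?_⟩
    filter_upwards [hlim₁.eventually (lt_mem_nhds hpos)] with n hn
    exact (hu n).elim (fun h => h.2) fun h => absurd h.1 hn.ne'

theorem isCompact_epiCone_slice [FiniteDimensional ℝ V] (hK : IsClosed (epiCone E)) {C : ℝ}
    (hC : ∀ p ∈ E, 1 * ‖p.1‖ - C ≤ p.2) :
    IsCompact (epiCone E ∩ {k | k.2.2 + (C + 1) * k.1 = 1}) := by
  refine Metric.isCompact_of_isClosed_isBounded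
    (hK.inter (isClosed_eq (by fun_prop) (by fun_prop))) (isBounded_iff_forall_norm_le.2
      ⟨1 + |C + 1|, ?_⟩)
  rintro ⟨α, x, τ⟩ ⟨hk, hslice : τ + (C + 1) * α = 1⟩
  have hα : 0 ≤ α := fst_nonneg_of_mem_epiCone hk
  have hx : 1 * ‖x‖ - C * α ≤ τ := le_of_mem_epiCone hC hk
  have hα1 : α ≤ 1 := by linarith [norm_nonneg x]
  have hCα : |(C + 1) * α| ≤ |C + 1| := by
    rw [abs_mul, abs_of_nonneg hα]
    exact mul_le_of_le_one_right (abs_nonneg _) hα1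
  have hτ : |τ| ≤ 1 + |C + 1| := by
    rw [eq_sub_of_add_eq hslice]
    exact (abs_sub _ _).trans (by simpa using hCα)
  have hC0 := abs_nonneg (C + 1)
  refine norm_prod_le_iff.2 ⟨?_, norm_prod_le_iff.2 ⟨?_, hτ⟩⟩
  · rw [Real.norm_of_nonneg hα]
    linarith
  · linarith

theorem exists_separation_ray_of_isCompact {W : Type*} [NormedAddCommGroup W] [NormedSpace ℝ W]
    [FiniteDimensional ℝ W] {B : Set W} (hB : IsCompact B) {p : W}
    (hp : ∀ a : ℝ, 0 ≤ a → a • p ∉ convexHull ℝ B) :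
    ∃ (φ : W →L[ℝ] ℝ) (u : ℝ), u < 0 ∧ (∀ b ∈ B, φ b < u) ∧ 0 ≤ φ p := by
  let ray : Set W := LinearMap.toSpanSingleton ℝ W p '' Set.Ici 0
  have hclosed : IsClosed ray := isClosedMap_smul_left p _ isClosed_Ici
  have hdisj : Disjoint (convexHull ℝ B) ray := by
    rw [Set.disjoint_right]
    rintro _ ⟨a, ha, rfl⟩
    exact hp a ha
  obtain ⟨φ, u, v, hu, huv, hv⟩ := geometric_hahn_banach_compact_closed (convex_convexHull ℝ B)
    (isCompact_convexHull_of_finiteDimensional hB) ((convex_Ici 0).linear_image _) hclosed hdisj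
  replace hv (a : ℝ) (ha : 0 ≤ a) : v < a * φ p := by
    simpa using hv (a • p) ⟨a, ha, rfl⟩
  have hv0 : v < 0 := by simpa using hv 0 le_rfl
  refine ⟨φ, u, huv.trans hv0, fun b hb => hu b (subset_convexHull ℝ B hb), ?_⟩
  by_contra! hneg
  have := hv (v / φ p) (div_nonneg_of_nonpos hv0.le hneg.le)
  rw [div_mul_cancel₀ _ hneg.ne] at this
  exact lt_irrefl v this

theorem exists_affine_minorant_of_neg_on_slice {C : ℝ} (hC : ∀ p ∈ E, 1 * ‖p.1‖ - C ≤ p.2)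
    {φ : ℝ × V × ℝ →L[ℝ] ℝ} {u : ℝ} (hu : u < 0)
    (hφ : ∀ k ∈ epiCone E ∩ {k | k.2.2 + (C + 1) * k.1 = 1}, φ k < u) :
    ∃ (ℓ : V →L[ℝ] ℝ) (r : ℝ), (∀ p ∈ E, ℓ p.1 + r ≤ p.2) ∧
      ∀ x t, ℓ x + r ≤ t → φ (1, x, t) ≤ u := by
  let ψ : V →L[ℝ] ℝ := φ ∘L .inr ℝ ℝ (V × ℝ) ∘L .inl ℝ V ℝ
  let s : ℝ := -φ (0, 0, 1)
  have hs : 0 < s := by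
    have := hφ (0, 0, 1) ⟨Or.inr ⟨rfl, rfl, zero_le_one⟩, by simp⟩
    exact neg_pos.2 (this.trans hu)
  have hφ_eq (x : V) (t : ℝ) : φ (1, x, t) = φ (1, 0, 0) + ψ x - s * t := by
    have : ((1 : ℝ), x, t) = (1, 0, 0) + (0, x, 0) + t • (0, 0, 1) := by simp
    rw [this, map_add, map_add, map_smul, smul_eq_mul]
    simp only [ψ, s, ContinuousLinearMap.comp_apply, ContinuousLinearMap.inl_apply,
      ContinuousLinearMap.inr_apply]
    ring
  have hiff (x : V) (t : ℝ) : (s⁻¹ • ψ) x + s⁻¹ * (φ (1, 0, 0) - u) ≤ t ↔ φ (1, x, t) ≤ u := by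
    rw [smul_apply, smul_eq_mul, ← mul_add, inv_mul_le_iff₀ hs, hφ_eq x t]
    constructor <;> intro h <;> linarith
  refine ⟨s⁻¹ • ψ, s⁻¹ * (φ (1, 0, 0) - u), fun p hp => (hiff _ _).2 ?_, fun x t => (hiff x t).1⟩
  let h : ℝ := p.2 + (C + 1) * 1
  have hh : 1 ≤ h := by linarith [hC p hp, norm_nonneg p.1]
  have hh0 : 0 < h := one_pos.trans_le hh
  have hneg := hφ (h⁻¹ • (1, p)) ⟨smul_mem_epiCone (mem_epiCone_of_mem hp) (inv_pos.2 hh0), by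
    simp only [Set.mem_ofPred_eq, Prod.smul_snd, Prod.smul_fst, smul_eq_mul]
    rw [mul_left_comm, ← mul_add, inv_mul_cancel₀ hh0.ne']⟩
  rw [map_smul, smul_eq_mul, inv_mul_lt_iff₀ hh0] at hneg
  exact hneg.le.trans (by nlinarith)

theorem mem_convexHull_of_forall_affine_minorant [FiniteDimensional ℝ V] (hclosed : IsClosed E)
    (hup : ∀ p ∈ E, ∀ r : ℝ, 0 ≤ r → p + (0, r) ∈ E)
    (hsuper : ∀ M : ℝ, ∃ C, ∀ p ∈ E, M * ‖p.1‖ - C ≤ p.2) {p : V × ℝ}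
    (hp : ∀ (ℓ : V →L[ℝ] ℝ) (r : ℝ), (∀ q ∈ E, ℓ q.1 + r ≤ q.2) → ℓ p.1 + r ≤ p.2) :
    p ∈ convexHull ℝ E := by
  obtain ⟨C, hC⟩ := hsuper 1
  obtain ⟨a, ha, hmem⟩ : ∃ a : ℝ, 0 ≤ a ∧
      a • ((1 : ℝ), p) ∈ convexHull ℝ (epiCone E ∩ {k | k.2.2 + (C + 1) * k.1 = 1}) := by
    by_contra! hdisj
    obtain ⟨φ, u, hu, hneg, hnonneg⟩ := exists_separation_ray_of_isCompact
      (isCompact_epiCone_slice (isClosed_epiCone hclosed hsuper) hC) hdisj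
    obtain ⟨ℓ, r, hminor, hle⟩ := exists_affine_minorant_of_neg_on_slice hC hu hneg
    exact (hnonneg.trans (hle p.1 p.2 (hp ℓ r hminor))).not_gt hu
  have hhull_up : ∀ q ∈ convexHull ℝ E, ∀ r : ℝ, 0 ≤ r → q + (0, r) ∈ convexHull ℝ E :=
    fun q hq r hr => convexHull_min (t := (· + (0, r)) ⁻¹' convexHull ℝ E)
      (fun q hq => subset_convexHull ℝ E (hup q hq r hr))
      ((convex_convexHull ℝ E).translate_preimage_left (0, r)) hq
  have hcone := convexHull_min (Set.inter_subset_left.trans (epiCone_mono (subset_convexHull ℝ E)))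
    (convex_epiCone (convex_convexHull ℝ E) hhull_up) hmem
  have hslice := convexHull_min Set.inter_subset_right
    (convex_hyperplane (f := fun k : ℝ × V × ℝ => k.2.2 + (C + 1) * k.1) ⟨fun _ _ => by
      simp only [Prod.snd_add, Prod.fst_add]; ring, fun _ _ => by
      simp only [Prod.smul_fst, Prod.smul_snd, smul_eq_mul]; ring⟩ 1) hmem
  have ha0 : a ≠ 0 := by
    rintro rfl
    simp at hslice
  rcases hcone with ⟨-, h⟩ | ⟨h, -⟩
  · simpa [smul_smul, ha0] using h
  · exact absurd (by simpa using h) ha0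

end ConvexHullOfEpigraph

section Biconjugate

variable {d : ℕ} {f : Euc d → EReal}

theorem fenchelConj_le_coe_iff {y : Euc d} {c : ℝ} :
    fenchelConj f y ≤ c ↔ ∀ z, ((inner ℝ y z - c : ℝ) : EReal) ≤ f z := by
  refine iSup_le_iff.trans (forall_congr' fun z => ?_)
  induction f z with
  | bot => simpa using EReal.coe_ne_bot (inner ℝ y z - c)
  | top => simp
  | coe a => norm_cast; exact sub_le_comm

theorem biconj_le_coe_iff {x : Euc d} {t : ℝ} :
    biconj f x ≤ t ↔ ∀ (y : Euc d) (r : ℝ), (∀ z, ((inner ℝ y z + r : ℝ) : EReal) ≤ f z) →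
      inner ℝ y x + r ≤ t := by
  have real_sub_le (a : ℝ) (e : EReal) :
      (a : EReal) - e ≤ t ↔ ∀ c : ℝ, e ≤ c → a - c ≤ t := by
    induction e with
    | bot => simpa [EReal.coe_sub_bot] using ⟨a - t - 1, by linarith⟩
    | top => simp
    | coe b => norm_cast; exact ⟨fun h c hc => by linarith, fun h => h b le_rfl⟩
  refine iSup_le_iff.trans (forall_congr' fun y => (real_sub_le _ _).trans ?_)
  simp only [fenchelConj_le_coe_iff, real_inner_comm y x]
  exact ⟨fun h r hr => by simpa using h (-r) (by simpa using hr),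
    fun h c hc => by simpa [sub_eq_add_neg] using h (-c) (by simpa [sub_eq_add_neg] using hc)⟩

theorem le_biconj_of_minorant {y : Euc d} {r : ℝ}
    (h : ∀ z, ((inner ℝ y z + r : ℝ) : EReal) ≤ f z) (x : Euc d) :
    ((inner ℝ y x + r : ℝ) : EReal) ≤ biconj f x :=
  EReal.le_of_forall_lt_iff_le.1 fun _ ht =>
    EReal.coe_le_coe_iff.2 (biconj_le_coe_iff.1 ht.le y r h)

theorem biconj_le_self (x : Euc d) : biconj f x ≤ f x :=
  EReal.le_of_forall_lt_iff_le.1 fun _ ht =>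
    biconj_le_coe_iff.2 fun _ _ h => EReal.coe_le_coe_iff.1 ((h x).trans ht.le)

theorem convex_epigraph_biconj : Convex ℝ {p : Euc d × ℝ | biconj f p.1 ≤ (p.2 : EReal)} := by
  simp only [biconj_le_coe_iff, Set.ofPred_forall]
  refine convex_iInter fun y => convex_iInter fun r => convex_iInter fun _ =>
    fun p hp q hq a b ha hb hab => ?_
  calc inner ℝ y (a • p.1 + b • q.1) + r = a * (inner ℝ y p.1 + r) + b * (inner ℝ y q.1 + r) := by
        rw [inner_add_right, real_inner_smul_right, real_inner_smul_right]
        linear_combination -r * hab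
    _ ≤ a * p.2 + b * q.2 :=
        add_le_add (mul_le_mul_of_nonneg_left hp ha) (mul_le_mul_of_nonneg_left hq hb)

theorem biconj_sum_le {ι : Type*} [Fintype ι] {w : ι → ℝ} (hw : ∀ i, 0 ≤ w i)
    (hw1 : ∑ i, w i = 1) {z : ι → Euc d} {t : ι → ℝ} (hz : ∀ i, biconj f (z i) ≤ t i) :
    biconj f (∑ i, w i • z i) ≤ ((∑ i, w i * t i : ℝ) : EReal) := by
  simpa [Prod.fst_sum, Prod.snd_sum] using convex_epigraph_biconj.sum_mem (fun i _ => hw i) hw1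
    (z := fun i => (z i, t i)) fun i _ => hz i

theorem isClosed_epigraph_biconj : IsClosed {p : Euc d × ℝ | biconj f p.1 ≤ (p.2 : EReal)} := by
  simp only [biconj_le_coe_iff, Set.ofPred_forall]
  exact isClosed_iInter fun y => isClosed_iInter fun r => isClosed_iInter fun _ =>
    isClosed_le (by fun_prop) (by fun_prop)

end Biconjugate

namespace GoodFunction

variable {d : ℕ} {f : Euc d → EReal}

theorem exists_norm_le (hf : GoodFunction f) (M : ℝ) :
    ∃ C : ℝ, ∀ x, ((M * ‖x‖ - C : ℝ) : EReal) ≤ f x := by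
  obtain ⟨y, r, hyr⟩ := hf.affine_minorant
  obtain ⟨R, -, hR⟩ := Filter.hasBasis_cobounded_norm.eventually_iff.1 (hf.coercive M)
  refine ⟨(|M| + ‖y‖) * |R| + |r|, fun x => ?_⟩
  rcases le_total R ‖x‖ with hx | hx
  · refine le_trans ?_ (hR hx)
    have h0 : 0 ≤ (|M| + ‖y‖) * |R| := by positivity
    exact_mod_cast (by linarith [abs_nonneg r])
  · refine le_trans ?_ (hyr x)
    have hxR : ‖x‖ ≤ |R| := hx.trans (le_abs_self R)
    have hM : M * ‖x‖ ≤ |M| * |R| := by gcongr; exact le_abs_self M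
    have hy : -(‖y‖ * |R|) ≤ inner ℝ y x :=
      (neg_le_neg (by gcongr)).trans (neg_le_of_abs_le (abs_real_inner_le_norm y x))
    exact_mod_cast (by linarith [neg_abs_le r])

theorem biconj_ne_bot (hf : GoodFunction f) (x : Euc d) : biconj f x ≠ ⊥ := by
  obtain ⟨y, r, hyr⟩ := hf.affine_minorant
  exact ne_bot_of_le_ne_bot (EReal.coe_ne_bot _) (le_biconj_of_minorant hyr x)

theorem coe_toReal_biconj (hf : GoodFunction f) {x : Euc d} (hx : biconj f x < ⊤) :
    (((biconj f x).toReal : ℝ) : EReal) = biconj f x :=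
  EReal.coe_toReal hx.ne (hf.biconj_ne_bot x)

theorem exists_norm_le_biconj (hf : GoodFunction f) :
    ∃ C : ℝ, ∀ x, ((‖x‖ - C : ℝ) : EReal) ≤ biconj f x := by
  obtain ⟨C, hC⟩ := hf.exists_norm_le 1
  refine ⟨C, fun x => ?_⟩
  let y : Euc d := ‖x‖⁻¹ • x
  have hy : ‖y‖ ≤ 1 := by simpa [y, norm_smul] using inv_mul_le_one
  have hyx : inner ℝ y x = ‖x‖ := by
    rw [real_inner_smul_left, real_inner_self_eq_norm_mul_norm, ← mul_assoc, inv_mul_mul_self]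
  have hminorant (z) : ((inner ℝ y z + -C : ℝ) : EReal) ≤ f z := by
    refine le_trans (EReal.coe_le_coe_iff.2 ?_) (hC z)
    have := (real_inner_le_norm y z).trans (mul_le_mul_of_nonneg_right hy (norm_nonneg z))
    linarith
  simpa only [hyx, ← sub_eq_add_neg] using le_biconj_of_minorant hminorant x

theorem mem_convexHull_epigraph (hf : GoodFunction f) {x : Euc d} {t : ℝ} (hx : biconj f x ≤ t) :
    (x, t) ∈ convexHull ℝ {p : Euc d × ℝ | f p.1 ≤ (p.2 : EReal)} := by
  refine mem_convexHull_of_forall_affine_minorant ?_ (fun p hp r hr => ?_) (fun M => ?_)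
    fun ℓ r hℓ => ?_
  · exact hf.lsc.isClosed_epigraph.preimage
      (continuous_fst.prodMk (continuous_coe_real_ereal.comp continuous_snd))
  · simp only [Set.mem_ofPred_eq, Prod.fst_add, Prod.snd_add, add_zero] at hp ⊢
    exact hp.trans (EReal.coe_le_coe_iff.2 (le_add_of_nonneg_right hr))
  · exact (hf.exists_norm_le M).imp fun C hC p hp => EReal.coe_le_coe_iff.1 ((hC p.1).trans hp)
  · let y := (InnerProductSpace.toDual ℝ (Euc d)).symm ℓ
    have hy (z) : inner ℝ y z = ℓ z := InnerProductSpace.toDual_symm_apply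
    have hminorant (z) : ((inner ℝ y z + r : ℝ) : EReal) ≤ f z :=
      EReal.le_of_forall_lt_iff_le.1 fun s hs =>
        EReal.coe_le_coe_iff.2 (by simpa only [hy] using hℓ (z, s) hs.le)
    simpa only [hy] using biconj_le_coe_iff.1 hx y r hminorant

/-- In a representation of a point of the graph of `f**` by points of the epigraph of `f`, Jensen's
inequality is an equality, so each of these points is on both graphs. -/
theorem mem_convexHull_contact (hf : GoodFunction f) {x : Euc d} (hx : biconj f x < ⊤) :
    (x, (biconj f x).toReal) ∈ convexHull ℝ
      {p : Euc d × ℝ | (p.2 : EReal) = biconj f p.1 ∧ f p.1 = biconj f p.1} := by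
  obtain ⟨ι, _, z, w, hz, -, hw, hw1, hsum⟩ := eq_pos_convex_span_of_mem_convexHull
    (hf.mem_convexHull_epigraph (hf.coe_toReal_biconj hx).ge)
  replace hz (i) : f (z i).1 ≤ ((z i).2 : EReal) := hz ⟨i, rfl⟩
  have hx_eq : ∑ i, w i • (z i).1 = x := by simpa [Prod.fst_sum] using congrArg Prod.fst hsum
  have ht_eq : ∑ i, w i * (z i).2 = (biconj f x).toReal := by
    simpa [Prod.snd_sum] using congrArg Prod.snd hsum
  have hb (i) : ((biconj f (z i).1).toReal : EReal) = biconj f (z i).1 :=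
    hf.coe_toReal_biconj ((biconj_le_self _).trans_lt ((hz i).trans_lt (EReal.coe_lt_top _)))
  have hle (i) : (biconj f (z i).1).toReal ≤ (z i).2 :=
    EReal.coe_le_coe_iff.1 ((hb i).trans_le ((biconj_le_self _).trans (hz i)))
  have hjensen : (biconj f x).toReal ≤ ∑ i, w i * (biconj f (z i).1).toReal := by
    have := biconj_sum_le (fun i => (hw i).le) hw1 fun i => (hb i).ge
    rwa [hx_eq, ← hf.coe_toReal_biconj hx, EReal.coe_le_coe_iff] at this
  have hmul_le (i) : w i * (biconj f (z i).1).toReal ≤ w i * (z i).2 :=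
    mul_le_mul_of_nonneg_left (hle i) (hw i).le
  have hmul_eq := (Finset.sum_eq_sum_iff_of_le fun i _ => hmul_le i).1
    ((Finset.sum_le_sum fun i _ => hmul_le i).antisymm (ht_eq.trans_le hjensen))
  have hgraph (i) : ((z i).2 : EReal) = biconj f (z i).1 := by
    rw [← hb, mul_left_cancel₀ (hw i).ne' (hmul_eq i (Finset.mem_univ i))]
  exact mem_convexHull_of_exists_fintype w z (fun i => (hw i).le) hw1
    (fun i => ⟨hgraph i, ((hz i).trans_eq (hgraph i)).antisymm (biconj_le_self _)⟩) hsum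

end GoodFunction

theorem ereal_coe_sum {ι : Type*} (s : Finset ι) (a : ι → ℝ) :
    ((∑ i ∈ s, a i : ℝ) : EReal) = ∑ i ∈ s, (a i : EReal) :=
  map_sum (⟨⟨Real.toEReal, EReal.coe_zero⟩, EReal.coe_add⟩ : ℝ →+ EReal) a s

theorem ereal_sum_ne_bot {ι : Type*} {s : Finset ι} {a : ι → EReal} (h : ∀ i ∈ s, a i ≠ ⊥) :
    ∑ i ∈ s, a i ≠ ⊥ :=
  Finset.sum_induction a (· ≠ ⊥) (fun _ _ hx hy => by simp [EReal.add_eq_bot_iff, hx, hy])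
    EReal.zero_ne_bot h

theorem lt_top_of_ereal_sum_lt_top {ι : Type*} [Fintype ι] {a : ι → EReal} (h : ∀ i, a i ≠ ⊥)
    (hs : ∑ i, a i < ⊤) (i : ι) : a i < ⊤ := by
  classical
  by_contra hi
  rw [← Finset.add_sum_erase _ _ (Finset.mem_univ i), not_lt_top_iff.1 hi,
    EReal.top_add_of_ne_bot (ereal_sum_ne_bot fun j _ => h j)] at hs
  exact lt_irrefl _ hs

theorem ereal_sum_eq_coe_toReal {ι : Type*} [Fintype ι] {a : ι → EReal} (h : ∀ i, a i ≠ ⊥)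
    (h' : ∀ i, a i < ⊤) : ∑ i, a i = ((∑ i, (a i).toReal : ℝ) : EReal) := by
  rw [ereal_coe_sum]
  exact Finset.sum_congr rfl fun i _ => (EReal.coe_toReal (h' i).ne (h i)).symm

theorem isClosed_image_snd_of_isBounded {X Y : Type*} [PseudoMetricSpace X] [ProperSpace X]
    [PseudoMetricSpace Y] {K : Set (X × Y)} (hK : IsClosed K)
    (hbdd : ∀ B : Set Y, Bornology.IsBounded B →
      Bornology.IsBounded (Prod.fst '' (K ∩ Prod.snd ⁻¹' B))) :
    IsClosed (Prod.snd '' K) := by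
  refine isClosed_of_closure_subset fun y hy => ?_
  obtain ⟨u, hu, hlim⟩ := mem_closure_iff_seq_limit.1 hy
  choose p hpK hpu using hu
  obtain ⟨x, -, φ, hφ, hx⟩ := tendsto_subseq_of_bounded
    (hbdd _ (Metric.isBounded_range_of_tendsto u hlim))
    fun k => ⟨p k, ⟨hpK k, k, (hpu k).symm⟩, rfl⟩
  have hy : Filter.Tendsto (fun k => (p (φ k)).2) Filter.atTop (nhds y) :=
    (hlim.comp hφ.tendsto_atTop).congr fun k => (hpu (φ k)).symm
  exact ⟨(x, y), hK.mem_of_tendsto (hx.prodMk_nhds hy) (.of_forall fun k => hpK (φ k)), rfl⟩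

namespace EpiSpace

variable {m : ℕ}

theorem finrank_eq (m : ℕ) : Module.finrank ℝ (EpiSpace m) = m + 1 := by
  rw [(WithLp.linearEquiv 2 ℝ (ℝ × EuclideanSpace ℝ (Fin m))).finrank_eq, Module.finrank_prod]
  simp [add_comm]

theorem fst_sum {ι : Type*} (s : Finset ι) (r : ι → EpiSpace m) :
    (∑ i ∈ s, r i).fst = ∑ i ∈ s, (r i).fst :=
  map_sum (WithLp.fstₗ 2 ℝ ℝ (EuclideanSpace ℝ (Fin m))) r s

theorem snd_sum {ι : Type*} (s : Finset ι) (r : ι → EpiSpace m) :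
    (∑ i ∈ s, r i).snd = ∑ i ∈ s, (r i).snd :=
  map_sum (WithLp.sndₗ 2 ℝ ℝ (EuclideanSpace ℝ (Fin m))) r s

end EpiSpace

namespace SepProblem

variable {n m : ℕ} {P : SepProblem n m}

theorem block_eq (i : Fin n) (x : Euc (P.d i)) : P.block i x = (P.A i).toEuclideanLin x := rfl

theorem block_sum {ι : Type*} (s : Finset ι) (i : Fin n) (w : ι → ℝ) (z : ι → Euc (P.d i)) :
    P.block i (∑ k ∈ s, w k • z k) = ∑ k ∈ s, w k • P.block i (z k) := by
  simp only [block_eq, map_sum, map_smul]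

theorem continuous_mulA : Continuous P.mulA :=
  continuous_finsetSum _ fun i _ =>
    ((P.A i).toEuclideanLin.continuous_of_finiteDimensional).comp (continuous_apply i)

theorem Feasible.combo {u u' : Euc m} {x x' : P.Var} (hx : P.Feasible u x)
    (hx' : P.Feasible u' x') {a b : ℝ} (ha : 0 ≤ a) (hb : 0 ≤ b) (hab : a + b = 1) :
    P.Feasible (a • u + b • u') (a • x + b • x') := fun k => by
  have hmulA : P.mulA (a • x + b • x') = a • P.mulA x + b • P.mulA x' := by
    simp only [mulA, Pi.add_apply, Pi.smul_apply, block_eq, map_add, map_smul,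
      Finset.sum_add_distrib, Finset.smul_sum]
  calc (P.mulA (a • x + b • x') - P.b) k
      = a * (P.mulA x - P.b) k + b * (P.mulA x' - P.b) k := by
        simp only [hmulA, PiLp.sub_apply, PiLp.add_apply, PiLp.smul_apply, smul_eq_mul]
        linear_combination P.b k * hab
    _ ≤ a * u k + b * u' k :=
        add_le_add (mul_le_mul_of_nonneg_left (hx k) ha) (mul_le_mul_of_nonneg_left (hx' k) hb)

variable (P) in
/-- The triples `((x, t), r)` such that `x` is feasible for the perturbation `r.snd`, each `t i`
bounds `fᵢ** (xᵢ)`, and `∑ i, t i ≤ r.fst`. The auxiliary `t` keeps all inequalities between real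
numbers. -/
def relaxedIncidence : Set ((P.Var × (Fin n → ℝ)) × EpiSpace m) :=
  {p | (∀ i, biconj (P.f i) (p.1.1 i) ≤ p.1.2 i) ∧ ∑ i, p.1.2 i ≤ p.2.fst ∧
    P.Feasible p.2.snd p.1.1}

variable (P) in
/-- The analogue of `epiG` for the convex relaxation. -/
def relaxedEpi : Set (EpiSpace m) := Prod.snd '' P.relaxedIncidence

theorem convex_relaxedIncidence : Convex ℝ P.relaxedIncidence := by
  rintro ⟨⟨x, t⟩, r⟩ ⟨hbiconj, hsum, hfeas⟩ ⟨⟨x', t'⟩, r'⟩ ⟨hbiconj', hsum', hfeas'⟩ a b ha hb hab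
  refine ⟨fun i => ?_, ?_, hfeas.combo hfeas' ha hb hab⟩
  · exact @convex_epigraph_biconj _ _ (x i, t i) (hbiconj i) (x' i, t' i) (hbiconj' i) a b ha hb hab
  · calc ∑ i, (a * t i + b * t' i) = a * ∑ i, t i + b * ∑ i, t' i := by
          rw [Finset.sum_add_distrib, Finset.mul_sum, Finset.mul_sum]
      _ ≤ a * r.fst + b * r'.fst :=
          add_le_add (mul_le_mul_of_nonneg_left hsum ha) (mul_le_mul_of_nonneg_left hsum' hb)

theorem isClosed_relaxedIncidence : IsClosed P.relaxedIncidence := by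
  have hfst : Continuous fun p : (P.Var × (Fin n → ℝ)) × EpiSpace m => p.2.fst :=
    (WithLp.continuous_fst 2 ℝ _).comp continuous_snd
  have hmulA : Continuous fun p : (P.Var × (Fin n → ℝ)) × EpiSpace m => P.mulA p.1.1 :=
    continuous_mulA.comp (continuous_fst.comp continuous_fst)
  simp only [relaxedIncidence, Feasible, Set.ofPred_and, Set.ofPred_forall]
  refine (isClosed_iInter fun i => ?_).inter
    ((isClosed_le (by fun_prop) hfst).inter (isClosed_iInter fun k => ?_))
  · exact isClosed_epigraph_biconj.preimage
      (f := fun p : (P.Var × (Fin n → ℝ)) × EpiSpace m => (p.1.1 i, p.1.2 i)) (by fun_prop)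
  · exact isClosed_le (by fun_prop) (by fun_prop)

theorem isBounded_fibre_relaxedIncidence (hf : ∀ i, GoodFunction (P.f i)) {B : Set (EpiSpace m)}
    (hB : Bornology.IsBounded B) :
    Bornology.IsBounded (Prod.fst '' (P.relaxedIncidence ∩ Prod.snd ⁻¹' B)) := by
  choose C hC using fun i => (hf i).exists_norm_le_biconj
  obtain ⟨R, hR⟩ := hB.exists_norm_le
  let D := R + ∑ i, C i
  have hballs : Bornology.IsBounded (Set.univ.pi fun i => Metric.closedBall (0 : Euc (P.d i)) D) :=
    .pi fun _ => Metric.isBounded_closedBall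
  have hIccs : Bornology.IsBounded (Set.univ.pi fun i => Set.Icc (-C i) (D - C i)) :=
    .pi fun _ => Metric.isBounded_Icc _ _
  refine (hballs.prod hIccs).subset ?_
  rintro - ⟨⟨⟨x, t⟩, r⟩, ⟨⟨hbiconj, hsum, -⟩, hr⟩, rfl⟩
  have hlow (i) : ‖x i‖ ≤ t i + C i :=
    sub_le_iff_le_add.1 (EReal.coe_le_coe_iff.1 ((hC i _).trans (hbiconj i)))
  have hup (i) : t i + C i ≤ D :=
    calc t i + C i ≤ ∑ j, (t j + C j) := Finset.single_le_sum (f := fun j => t j + C j)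
          (fun j _ => (norm_nonneg _).trans (hlow j)) (Finset.mem_univ i)
      _ = ∑ j, t j + ∑ j, C j := Finset.sum_add_distrib
      _ ≤ D := by
        have hfst : r.fst ≤ R :=
          (le_abs_self _).trans ((WithLp.norm_fst_le _ r).trans (hR r hr))
        exact add_le_add_left (hsum.trans hfst) _
  refine ⟨fun i _ => ?_, fun i _ => ⟨?_, ?_⟩⟩
  · exact mem_closedBall_zero_iff.2 ((hlow i).trans (hup i))
  · exact neg_le_iff_add_nonneg.2 ((norm_nonneg _).trans (hlow i))
  · exact le_sub_iff_add_le.2 (hup i)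

theorem mem_relaxedEpi_of_feasible (hf : ∀ i, GoodFunction (P.f i)) {u : Euc m} {x : P.Var}
    (hx : P.Feasible u x) {a : ℝ} (ha : ∑ i, biconj (P.f i) (x i) ≤ a) :
    WithLp.toLp 2 (a, u) ∈ P.relaxedEpi := by
  have hbot (i) := (hf i).biconj_ne_bot (x i)
  have hlt := lt_top_of_ereal_sum_lt_top hbot (ha.trans_lt (EReal.coe_lt_top a))
  rw [ereal_sum_eq_coe_toReal hbot hlt, EReal.coe_le_coe_iff] at ha
  exact ⟨((x, fun i => (biconj (P.f i) (x i)).toReal), WithLp.toLp 2 (a, u)),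
    ⟨fun i => ((hf i).coe_toReal_biconj (hlt i)).ge, ha, hx⟩, rfl⟩

theorem epiG_subset_relaxedEpi (hf : ∀ i, GoodFunction (P.f i)) : P.epiG ⊆ P.relaxedEpi := by
  rintro r ⟨x, hx, hfeas⟩
  exact mem_relaxedEpi_of_feasible hf hfeas
    ((Finset.sum_le_sum fun i _ => biconj_le_self (x i)).trans hx)

theorem convex_relaxedEpi : Convex ℝ P.relaxedEpi :=
  convex_relaxedIncidence.is_linear_image (LinearMap.snd ℝ _ _).isLinear

theorem isClosed_relaxedEpi (hf : ∀ i, GoodFunction (P.f i)) : IsClosed P.relaxedEpi :=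
  isClosed_image_snd_of_isBounded isClosed_relaxedIncidence
    fun _ => isBounded_fibre_relaxedIncidence hf

theorem epiGHull_subset_relaxedEpi (hf : ∀ i, GoodFunction (P.f i)) :
    P.epiGHull ⊆ P.relaxedEpi :=
  closure_minimal (convexHull_min (epiG_subset_relaxedEpi hf) convex_relaxedEpi)
    (isClosed_relaxedEpi hf)

end SepProblem

theorem EpiSpace.exists_nonneg_multiplier {m : ℕ} {E : Set (EpiSpace m)} (hconv : Convex ℝ E)
    (hclosed : IsClosed E) {v t : ℝ}
    (hup : ∀ (a : ℝ) (b : Euc m), v ≤ a → (∀ k, 0 ≤ b k) → WithLp.toLp 2 (a, b) ∈ E)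
    (ht : WithLp.toLp 2 (t, (0 : Euc m)) ∉ E) :
    ∃ l : Euc m, (∀ k, 0 ≤ l k) ∧ ∀ r ∈ E, t ≤ r.fst + inner ℝ l r.snd := by
  have htv : t < v := lt_of_not_ge fun hvt => ht (hup t 0 hvt fun _ => le_rfl)
  obtain ⟨φ, u, hφt, hφE⟩ := geometric_hahn_banach_point_closed hconv hclosed ht
  let q := (InnerProductSpace.toDual ℝ (EpiSpace m)).symm φ
  have hφ (r : EpiSpace m) : φ r = q.fst * r.fst + inner ℝ q.snd r.snd := by
    rw [← InnerProductSpace.toDual_symm_apply, WithLp.prod_inner_apply]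
    simp only [q, RCLike.inner_apply, conj_trivial, mul_comm, WithLp.ofLp_fst, WithLp.ofLp_snd]
  simp only [hφ] at hφt hφE
  simp only [WithLp.toLp_fst, WithLp.toLp_snd, inner_zero_right, add_zero] at hφt
  have hlt (b : Euc m) (hb : ∀ k, 0 ≤ b k) : u < q.fst * v + inner ℝ q.snd b :=
    hφE _ (hup v b le_rfl hb)
  have hu : u < q.fst * v := by simpa using hlt 0 fun _ => le_rfl
  have hpos : 0 < q.fst := pos_of_mul_pos_left (by linarith [mul_sub q.fst v t]) (sub_pos.2 htv).le
  have hnonneg (k) : 0 ≤ q.snd k := by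
    by_contra! hneg
    let a := (u - q.fst * v) / q.snd k
    have ha : 0 ≤ a := div_nonneg_of_nonpos (sub_nonpos.2 hu.le) hneg.le
    have hcontra := hlt (EuclideanSpace.single k a) fun j => by
      rw [PiLp.single_apply]
      split_ifs <;> simp [ha]
    rw [EuclideanSpace.inner_single_right, conj_trivial, div_mul_cancel₀ _ hneg.ne] at hcontra
    linarith
  refine ⟨q.fst⁻¹ • q.snd, fun k => mul_nonneg (inv_nonneg.2 hpos.le) (hnonneg k), fun r hr => ?_⟩
  refine le_of_mul_le_mul_left ?_ hpos
  rw [real_inner_smul_left, mul_add, mul_inv_cancel_left₀ hpos.ne']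
  exact (hφt.trans (hφE r hr)).le

namespace SepProblem

variable {n m : ℕ} {P : SepProblem n m}

theorem Feasible.mono {u u' : Euc m} (h : ∀ k, u k ≤ u' k) {x : P.Var} (hx : P.Feasible u x) :
    P.Feasible u' x :=
  fun k => (hx k).trans (h k)

theorem hP_anti {u u' : Euc m} (h : ∀ k, u k ≤ u' k) : P.hP u' ≤ P.hP u :=
  biInf_mono fun _ hx => hx.mono h

theorem hCoP_anti {u u' : Euc m} (h : ∀ k, u k ≤ u' k) : P.hCoP u' ≤ P.hCoP u :=
  biInf_mono fun _ hx => hx.mono h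

theorem hCoP_le_hP (u : Euc m) : P.hCoP u ≤ P.hP u :=
  iInf₂_mono fun _ _ => Finset.sum_le_sum fun _ _ => biconj_le_self _

theorem exists_of_mem_relaxedEpi {u : Euc m} {a : ℝ}
    (h : WithLp.toLp 2 (a, u) ∈ P.relaxedEpi) :
    ∃ x, P.Feasible u x ∧ (∀ i, biconj (P.f i) (x i) < ⊤) ∧ ∑ i, biconj (P.f i) (x i) ≤ a := by
  obtain ⟨⟨⟨x, t⟩, r⟩, ⟨hbiconj, hsum, hfeas⟩, rfl⟩ := h
  refine ⟨x, hfeas, fun i => (hbiconj i).trans_lt (EReal.coe_lt_top _), ?_⟩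
  refine (Finset.sum_le_sum fun i _ => hbiconj i).trans ?_
  rw [← ereal_coe_sum]
  exact EReal.coe_le_coe_iff.2 hsum

theorem hCoP_le_coe_iff_mem_relaxedEpi (hf : ∀ i, GoodFunction (P.f i)) {u : Euc m} {a : ℝ} :
    P.hCoP u ≤ a ↔ WithLp.toLp 2 (a, u) ∈ P.relaxedEpi := by
  constructor
  · intro h
    have hclosed : IsClosed {c : ℝ | WithLp.toLp 2 (c, u) ∈ P.relaxedEpi} :=
      (isClosed_relaxedEpi hf).preimage ((WithLp.prod_continuous_toLp 2 ℝ (Euc m)).comp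
        (continuous_id.prodMk continuous_const))
    have hIoi : Set.Ioi a ⊆ {c : ℝ | WithLp.toLp 2 (c, u) ∈ P.relaxedEpi} := fun c hc => by
      have hlt := h.trans_lt (EReal.coe_lt_coe_iff.2 hc)
      simp only [hCoP, iInf_lt_iff] at hlt
      obtain ⟨x, hx, hlt⟩ := hlt
      exact mem_relaxedEpi_of_feasible hf hx hlt.le
    exact closure_minimal hIoi hclosed (by rw [closure_Ioi]; exact Set.self_mem_Ici)
  · intro h
    obtain ⟨x, hx, -, hle⟩ := exists_of_mem_relaxedEpi h
    exact (iInf₂_le x hx).trans hle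

theorem hCoP_ne_bot (hf : ∀ i, GoodFunction (P.f i)) (u : Euc m) : P.hCoP u ≠ ⊥ := by
  choose C hC using fun i => (hf i).exists_norm_le_biconj
  refine ne_bot_of_le_ne_bot (EReal.coe_ne_bot (∑ i, -C i)) (le_iInf₂ fun x _ => ?_)
  rw [ereal_coe_sum]
  refine Finset.sum_le_sum fun i _ => le_trans (EReal.coe_le_coe_iff.2 ?_) (hC i (x i))
  linarith [norm_nonneg (x i)]

theorem exists_isRelaxedOptimal (hf : ∀ i, GoodFunction (P.f i)) (h : P.hCoP 0 < ⊤) :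
    ∃ x, P.IsRelaxedOptimal x := by
  have hcoe : ((P.hCoP 0).toReal : EReal) = P.hCoP 0 :=
    EReal.coe_toReal h.ne (hCoP_ne_bot hf 0)
  obtain ⟨x, hx, hlt, hle⟩ := exists_of_mem_relaxedEpi
    ((hCoP_le_coe_iff_mem_relaxedEpi hf).1 hcoe.ge)
  exact ⟨x, hx, hlt, (hle.trans_eq hcoe).antisymm (iInf₂_le x hx)⟩

theorem exists_le_dualFun (hf : ∀ i, GoodFunction (P.f i)) (h : P.hCoP 0 < ⊤) {t : ℝ}
    (ht : (t : EReal) < P.hCoP 0) : ∃ l : Euc m, (∀ k, 0 ≤ l k) ∧ (t : EReal) ≤ P.dualFun l := by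
  have hcoe : ((P.hCoP 0).toReal : EReal) = P.hCoP 0 :=
    EReal.coe_toReal h.ne (hCoP_ne_bot hf 0)
  obtain ⟨l, hl, hle⟩ := EpiSpace.exists_nonneg_multiplier (t := t) convex_relaxedEpi
    (isClosed_relaxedEpi hf) (fun a b ha hb => (hCoP_le_coe_iff_mem_relaxedEpi hf).1
      ((hCoP_anti hb).trans (hcoe.ge.trans (EReal.coe_le_coe_iff.2 ha))))
    fun hmem => ht.not_ge ((hCoP_le_coe_iff_mem_relaxedEpi hf).2 hmem)
  exact ⟨l, hl, le_iInf₂ fun r hr => EReal.coe_le_coe_iff.2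
    (hle r (epiGHull_subset_relaxedEpi hf hr))⟩

theorem IsDualOptimal.hCoP_le_dualFun (hf : ∀ i, GoodFunction (P.f i)) (h : P.hCoP 0 < ⊤)
    {l : Euc m} (hl : P.IsDualOptimal l) : P.hCoP 0 ≤ P.dualFun l :=
  EReal.ge_of_forall_gt_iff_ge.1 fun _ ht =>
    let ⟨l', hl', hle⟩ := exists_le_dualFun hf h ht
    hle.trans (hl.2 l' hl')

theorem sumPoint_fst (x : P.Var) : (P.sumPoint x).fst = ∑ i, (biconj (P.f i) (x i)).toReal :=
  EpiSpace.fst_sum _ _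

theorem sumPoint_snd (x : P.Var) : (P.sumPoint x).snd = P.mulA x :=
  EpiSpace.snd_sum _ _

theorem zStar_fst (x : P.Var) (w : Euc m) : (P.zStar x w).fst = (P.sumPoint x).fst :=
  add_zero (P.sumPoint x).fst

theorem zStar_snd (x : P.Var) (w : Euc m) : (P.zStar x w).snd = P.mulA x + (w - P.b) :=
  congrArg (· + (w - P.b)) (sumPoint_snd x)

theorem IsRelaxedOptimal.coe_sumPoint_fst (hf : ∀ i, GoodFunction (P.f i)) {x : P.Var}
    (hx : P.IsRelaxedOptimal x) : (((P.sumPoint x).fst : ℝ) : EReal) = P.hCoP 0 := by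
  rw [← hx.2.2, sumPoint_fst, ereal_sum_eq_coe_toReal (fun i => (hf i).biconj_ne_bot _) hx.2.1]

theorem toLp_mem_convexHull_contactF {i : Fin n} (hf : GoodFunction (P.f i)) {x : Euc (P.d i)}
    (hx : biconj (P.f i) x < ⊤) :
    WithLp.toLp 2 ((biconj (P.f i) x).toReal, P.block i x) ∈ convexHull ℝ (P.contactF i) := by
  let T : Euc (P.d i) × ℝ →ₗ[ℝ] EpiSpace m := (WithLp.linearEquiv 2 ℝ (ℝ × Euc m)).symm ∘ₗ
    (LinearMap.snd ℝ (Euc (P.d i)) ℝ).prod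
      ((P.A i).toEuclideanLin ∘ₗ LinearMap.fst ℝ (Euc (P.d i)) ℝ)
  have himage : T (x, (biconj (P.f i) x).toReal) ∈ convexHull ℝ (T '' _) :=
    T.image_convexHull _ ▸ Set.mem_image_of_mem T (hf.mem_convexHull_contact hx)
  refine convexHull_mono ?_ himage
  rintro - ⟨⟨z, τ⟩, ⟨hτ, hz⟩, rfl⟩
  exact ⟨z, hτ, hz, rfl⟩

open scoped Pointwise in
theorem sum_add_mem_convexHull_epiG {r : Fin n → EpiSpace m}
    (hr : ∀ i, r i ∈ convexHull ℝ (P.contactF i)) :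
    ∑ i, r i + WithLp.toLp 2 ((0 : ℝ), -P.b) ∈ convexHull ℝ P.epiG := by
  have hsum : ∑ i, r i ∈ convexHull ℝ (∑ i, P.contactF i) := by
    rw [convexHull_sum]
    exact Set.finsetSum_mem_finsetSum _ _ _ fun i _ => hr i
  have hsub : ∑ i, P.contactF i ⊆
      (· + WithLp.toLp 2 ((0 : ℝ), -P.b)) ⁻¹' convexHull ℝ P.epiG := by
    intro v hv
    refine subset_convexHull ℝ _ ?_
    obtain ⟨g, hg, rfl⟩ := (Set.mem_finsetSum _ _ _).1 hv
    choose y hfst hcontact hsnd using fun i => hg (Finset.mem_univ i)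
    refine ⟨y, le_of_eq ?_, fun k => le_of_eq ?_⟩
    · rw [WithLp.add_fst, EpiSpace.fst_sum, WithLp.toLp_fst, add_zero, ereal_coe_sum]
      exact Finset.sum_congr rfl fun i _ => (hcontact i).trans (hfst i).symm
    · simp only [WithLp.add_snd, EpiSpace.snd_sum, WithLp.toLp_snd, ← sub_eq_add_neg, mulA, hsnd]
  exact convexHull_min hsub ((convex_convexHull ℝ _).translate_preimage_left _) hsum

theorem IsRelaxedOptimal.isDualMinimizer_zStar_zero (hf : ∀ i, GoodFunction (P.f i)) {x : P.Var}
    (hx : P.IsRelaxedOptimal x) : P.IsDualMinimizer (P.zStar x 0) := by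
  have hmem : P.zStar x 0 ∈ P.epiGHull := by
    rw [zStar, zero_sub]
    exact subset_closure (sum_add_mem_convexHull_epiG fun i =>
      toLp_mem_convexHull_contactF (hf i) (hx.2.1 i))
  refine ⟨hmem, fun l hl => (?_ : _ ≤ P.dualFun l).antisymm (iInf₂_le _ hmem)⟩
  have hfin : P.hCoP 0 < ⊤ := hx.coe_sumPoint_fst hf ▸ EReal.coe_lt_top _
  have hslack : inner ℝ l (P.mulA x - P.b) ≤ 0 := by
    rw [PiLp.inner_apply]
    exact Finset.sum_nonpos fun k _ => mul_nonpos_of_nonpos_of_nonneg (hx.1 k) (hl.1 k)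
  refine le_trans ?_ (hl.hCoP_le_dualFun hf hfin)
  rw [← hx.coe_sumPoint_fst hf, EReal.coe_le_coe_iff, zStar_fst, zStar_snd, zero_sub,
    ← sub_eq_add_neg]
  exact add_le_of_nonpos_right hslack

theorem exists_isOptimalRepresentation (hf : ∀ i, GoodFunction (P.f i)) (h : P.hCoP 0 < ⊤) :
    ∃ x w lam z, P.IsOptimalRepresentation x w lam z := by
  obtain ⟨x, hx⟩ := exists_isRelaxedOptimal hf h
  obtain ⟨lam, z, hlam, hlam1, hz, hsum, hcard⟩ :=
    shapley_folkman (κ := Fin (m + 2)) (by simp [EpiSpace.finrank_eq]) fun i =>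
      toLp_mem_convexHull_contactF (hf i) (hx.2.1 i)
  rw [Fintype.card_fin, EpiSpace.finrank_eq] at hcard
  exact ⟨x, 0, lam, z, hx, fun _ => le_rfl, hx.isDualMinimizer_zStar_zero hf,
    ⟨hlam, hlam1, hz⟩, by rw [hsum]; rfl, hcard⟩

end SepProblem

theorem GoodFunction.le_add_rhoK {d : ℕ} {f : Euc d → EReal} (hf : GoodFunction f)
    {J : Type*} [Fintype J] {w : J → ℝ} {z : J → Euc d} (hw : ∀ j, 0 ≤ w j)
    (hw1 : ∑ j, w j = 1) (hz : ∀ j, f (z j) < ⊤) :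
    f (∑ j, w j • z j) ≤
      ((∑ j, w j * (f (z j)).toReal : ℝ) : EReal) + rhoK f #{j | w j ≠ 0} := by
  obtain ⟨g, α, hα, hα1, hbary, hvalue, hcard⟩ := exists_caratheodory_le (κ := Fin (d + 1))
    (by simp) z (fun j => (f (z j)).toReal) hw hw1
  have hsum : ∑ j, (α j : EReal) * f (z (g j)) = (∑ j, α j * (f (z (g j))).toReal : ℝ) := by
    rw [ereal_coe_sum]
    refine Finset.sum_congr rfl fun j _ => ?_
    rw [EReal.coe_mul, EReal.coe_toReal (hz _).ne (hf.ne_bot _)]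
  have hrho : f (∑ j, α j • z (g j)) - ∑ j, (α j : EReal) * f (z (g j)) ≤
      rhoK f #{j | w j ≠ 0} := by
    unfold rhoK
    exact le_iSup₂_of_le (fun j => z (g j)) α
      (le_iSup_of_le ⟨fun j => hz _, hα, hα1, hcard⟩ le_rfl)
  rw [hsum, hbary, EReal.sub_le_iff_le_add (.inl (EReal.coe_ne_bot _))
    (.inl (EReal.coe_ne_top _)), add_comm] at hrho
  exact hrho.trans (add_le_add_left (EReal.coe_le_coe_iff.2 hvalue) _)

namespace SepProblem

variable {n m : ℕ} {P : SepProblem n m}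

theorem IsCombination.one_le_card_support {lam : Fin n → Fin (m + 2) → ℝ}
    {z : Fin n → Fin (m + 2) → EpiSpace m} (h : P.IsCombination lam z) (i : Fin n) :
    1 ≤ #{j | lam i j ≠ 0} := by
  obtain ⟨j, -, hj⟩ := Finset.exists_ne_zero_of_sum_ne_zero ((h.2.1 i).trans_ne one_ne_zero)
  exact Finset.card_pos.2 ⟨j, (Finset.mem_filter_univ j).2 hj⟩

theorem IsCombination.hP_le_add_sum_rhoK (hf : ∀ i, GoodFunction (P.f i))
    {lam : Fin n → Fin (m + 2) → ℝ} {z : Fin n → Fin (m + 2) → EpiSpace m}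
    (h : P.IsCombination lam z) :
    P.hP ((∑ i, ∑ j, lam i j • z i j).snd - P.b) ≤
      ((∑ i, ∑ j, lam i j • z i j).fst : EReal) + ∑ i, rhoK (P.f i) #{j | lam i j ≠ 0} := by
  obtain ⟨hlam, hlam1, hz⟩ := h
  choose p hfst hcontact hsnd using hz
  have hfp (i j) : P.f i (p i j) = (z i j).fst := (hcontact i j).trans (hfst i j).symm
  have hfeas : P.Feasible ((∑ i, ∑ j, lam i j • z i j).snd - P.b)
      fun i => ∑ j, lam i j • p i j := fun k => by
    simp only [mulA, block_sum, EpiSpace.snd_sum, WithLp.smul_snd, hsnd, le_refl]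
  have hblock (i) : P.f i (∑ j, lam i j • p i j) ≤
      ((∑ j, lam i j * (z i j).fst : ℝ) : EReal) + rhoK (P.f i) #{j | lam i j ≠ 0} := by
    simpa only [hfp, EReal.toReal_coe] using (hf i).le_add_rhoK (hlam i) (hlam1 i)
      fun j => (hfp i j).trans_lt (EReal.coe_lt_top _)
  refine ((iInf₂_le _ hfeas).trans (Finset.sum_le_sum fun i _ => hblock i)).trans_eq ?_
  simp only [Finset.sum_add_distrib, ← ereal_coe_sum, EpiSpace.fst_sum, WithLp.smul_fst,
    smul_eq_mul]

theorem IsSparseError.gapBound (hf : ∀ i, GoodFunction (P.f i)) {x : P.Var} {w : Euc m}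
    (hx : P.IsRelaxedOptimal x) {s : ℝ} {u : EpiSpace m}
    (hu : P.IsSparseError (P.zStar x w) w s u) : P.GapBound s u := by
  refine ⟨hCoP_le_hP _, ?_⟩
  obtain ⟨μ, y, hμ, hs, rfl⟩ := hu
  set v := ∑ i, ∑ j, μ i j • y i j
  set u := v + WithLp.toLp 2 ((0 : ℝ), w - P.b) - P.zStar x w with hu
  have hfst : v.fst = (P.sumPoint x).fst + u.fst := by
    simp [hu, zStar_fst]
  have hsnd (k) : (v.snd - P.b) k ≤ u.snd k := by
    have hdiff : v.snd - P.b - u.snd = P.mulA x - P.b := by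
      simp only [hu, WithLp.sub_snd, WithLp.add_snd, WithLp.toLp_snd, zStar_snd]
      abel
    have hk : (v.snd - P.b - u.snd) k ≤ 0 := hdiff ▸ hx.1 k
    exact sub_nonpos.1 hk
  have hrho : ∑ i, rhoK (P.f i) #{j | μ i j ≠ 0} ≤ P.maxRho s := by
    refine le_iSup₂_of_le (fun i => #{j | μ i j ≠ 0}) ⟨fun i => ⟨hμ.one_le_card_support i, ?_⟩, hs⟩
      le_rfl
    exact (Finset.card_le_univ _).trans_eq (Fintype.card_fin _)
  calc P.hP u.snd ≤ P.hP (v.snd - P.b) := hP_anti hsnd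
    _ ≤ (v.fst : EReal) + P.maxRho s := (hμ.hP_le_add_sum_rhoK hf).trans (by gcongr)
    _ ≤ (((P.sumPoint x).fst + |u.fst| : ℝ) : EReal) + P.maxRho s := by
        rw [hfst]
        gcongr
        exact le_abs_self _
    _ = P.hCoP 0 + (((|u.fst| : ℝ) : EReal) + P.maxRho s) := by
        rw [EReal.coe_add, hx.coe_sumPoint_fst hf, add_assoc]

end SepProblem

section Sampling

variable {E I J K T : Type*} [NormedAddCommGroup E] [InnerProductSpace ℝ E] [Fintype J]

theorem sum_mul_norm_sub_sum_add_sq {p : J → ℝ} (hp1 : ∑ j, p j = 1) (X : J → E) (r : E) :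
    ∑ j, p j * ‖X j - ∑ k, p k • X k + r‖ ^ 2 =
      ‖r‖ ^ 2 + ∑ j, p j * ‖X j‖ ^ 2 - ‖∑ j, p j • X j‖ ^ 2 := by
  set e := ∑ k, p k • X k with he
  have hexpand (j) : p j * ‖X j - e + r‖ ^ 2 =
      p j * ‖X j‖ ^ 2 + 2 * inner ℝ (p j • X j) (r - e) + p j * ‖r - e‖ ^ 2 := by
    rw [sub_add_eq_add_sub, add_sub_assoc, norm_add_sq_real, real_inner_smul_left]
    ring
  have hcross : ∑ j, inner ℝ (p j • X j) (r - e) = inner ℝ e (r - e) := by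
    rw [he, sum_inner]
  rw [Finset.sum_congr rfl fun j _ => hexpand j, Finset.sum_add_distrib, Finset.sum_add_distrib,
    ← Finset.mul_sum, ← Finset.sum_mul, hp1, hcross, inner_sub_right, real_inner_self_eq_norm_sq,
    norm_sub_sq_real, real_inner_comm]
  ring

theorem exists_norm_sub_sum_add_sq_le {p : J → ℝ} (hp : p ∈ stdSimplex ℝ J) (X : J → E) (r : E) :
    ∃ j, ‖X j - ∑ k, p k • X k + r‖ ^ 2 ≤ ‖r‖ ^ 2 + ∑ j, p j * ‖X j‖ ^ 2 := by
  obtain ⟨j, -, hj⟩ := (concaveOn_id convex_univ).exists_le_of_centerMass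
    (p := fun j => ‖X j - ∑ k, p k • X k + r‖ ^ 2) (fun j _ => hp.1 j)
    (hp.2.symm ▸ one_pos) fun _ _ => Set.mem_univ _
  rw [Finset.centerMass_eq_of_sum_1 _ _ hp.2] at hj
  simp only [id, smul_eq_mul, sum_mul_norm_sub_sum_add_sq hp.2] at hj
  exact ⟨j, hj.trans (sub_le_self _ (sq_nonneg _))⟩

theorem exists_choice_norm_sum_sub_sq_le {p : T → J → ℝ} (hp : ∀ t, p t ∈ stdSimplex ℝ J)
    (X : T → J → E) (S : Finset T) :
    ∃ c : T → J, ‖∑ t ∈ S, (X t (c t) - ∑ j, p t j • X t j)‖ ^ 2 ≤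
      ∑ t ∈ S, ∑ j, p t j * ‖X t j‖ ^ 2 := by
  classical
  induction S using Finset.induction_on with
  | empty =>
    choose c _ using fun t => exists_norm_sub_sum_add_sq_le (hp t) (X t) 0
    exact ⟨c, by simp⟩
  | insert t S ht ih =>
    obtain ⟨c, hc⟩ := ih
    obtain ⟨j, hj⟩ := exists_norm_sub_sum_add_sq_le (hp t) (X t)
      (∑ t ∈ S, (X t (c t) - ∑ j, p t j • X t j))
    have hupdate : ∑ s ∈ S, (X s (Function.update c t j s) - ∑ j, p s j • X s j) =
        ∑ s ∈ S, (X s (c s) - ∑ j, p s j • X s j) :=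
      Finset.sum_congr rfl fun s hs => by rw [Function.update_of_ne (ne_of_mem_of_not_mem hs ht)]
    refine ⟨Function.update c t j, ?_⟩
    rw [Finset.sum_insert ht, Finset.sum_insert ht, Function.update_self, hupdate]
    linarith

variable [Fintype K]

open Classical in
/-- The empirical distribution of a finite sample `c`. -/
noncomputable def empiricalWeight (c : K → J) (j : J) : ℝ := (#{k | c k = j} : ℝ) / Fintype.card K

theorem sum_empiricalWeight_smul {M : Type*} [AddCommGroup M] [Module ℝ M] (c : K → J)
    (z : J → M) :
    ∑ j, empiricalWeight c j • z j = (Fintype.card K : ℝ)⁻¹ • ∑ k, z (c k) := by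
  classical
  rw [← Finset.sum_fiberwise _ c, Finset.smul_sum]
  refine Finset.sum_congr rfl fun j _ => ?_
  rw [Finset.sum_congr rfl fun k hk => by rw [(Finset.mem_filter_univ k).1 hk], Finset.sum_const,
    ← Nat.cast_smul_eq_nsmul ℝ, smul_smul, empiricalWeight, div_eq_inv_mul]

theorem empiricalWeight_mem_stdSimplex [Nonempty K] (c : K → J) :
    empiricalWeight c ∈ stdSimplex ℝ J := by
  refine ⟨fun j => by unfold empiricalWeight; positivity, ?_⟩
  simpa using sum_empiricalWeight_smul c fun _ => (1 : ℝ)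

theorem card_support_empiricalWeight_le (c : K → J) :
    #{j | empiricalWeight c j ≠ 0} ≤ Fintype.card K := by
  classical
  have hsub : ({j | empiricalWeight c j ≠ 0} : Finset J) ⊆ Finset.univ.image c := by
    intro j hj
    simp only [empiricalWeight, Finset.mem_filter_univ, ne_eq, div_eq_zero_iff, Nat.cast_eq_zero,
      not_or] at hj
    obtain ⟨k, hk⟩ := Finset.card_ne_zero.1 hj.1
    exact Finset.mem_image.2 ⟨k, Finset.mem_univ k, (Finset.mem_filter_univ k).1 hk⟩
  exact (Finset.card_le_card hsub).trans Finset.card_image_le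

theorem exists_resampling {lam : I → J → ℝ} (hlam : ∀ i, lam i ∈ stdSimplex ℝ J) [Fintype I]
    (z : I → J → E) (S : Finset I) {q : ℕ} (hq : 0 < q) :
    ∃ μ : I → J → ℝ, (∀ i, μ i ∈ stdSimplex ℝ J) ∧ (∀ i ∈ S, #{j | μ i j ≠ 0} ≤ q) ∧
      (∀ i ∉ S, μ i = lam i) ∧
      q * ‖∑ i, ∑ j, μ i j • z i j - ∑ i, ∑ j, lam i j • z i j‖ ^ 2 ≤
        ∑ i ∈ S, ∑ j, lam i j * ‖z i j‖ ^ 2 := by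
  classical
  have : NeZero q := ⟨hq.ne'⟩
  have hq0 : (0 : ℝ) < q := Nat.cast_pos.2 hq
  obtain ⟨c, hc⟩ := exists_choice_norm_sum_sub_sq_le (T := I × Fin q) (fun t => hlam t.1)
    (fun t => z t.1) (S ×ˢ Finset.univ)
  let μ (i : I) : J → ℝ := if i ∈ S then empiricalWeight fun t : Fin q => c (i, t) else lam i
  have hμ_mem {i} (hi : i ∈ S) : μ i = empiricalWeight fun t => c (i, t) := if_pos hi
  have hμ_notMem {i} (hi : i ∉ S) : μ i = lam i := if_neg hi
  refine ⟨μ, fun i => ?_, fun i hi => ?_, fun i hi => hμ_notMem hi, ?_⟩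
  · by_cases hi : i ∈ S
    · exact hμ_mem hi ▸ empiricalWeight_mem_stdSimplex _
    · exact hμ_notMem hi ▸ hlam i
  · rw [hμ_mem hi]
    exact (card_support_empiricalWeight_le _).trans_eq (Fintype.card_fin q)
  have herr : (q : ℝ) • (∑ i, ∑ j, μ i j • z i j - ∑ i, ∑ j, lam i j • z i j) =
      ∑ t ∈ S ×ˢ Finset.univ, (z t.1 (c t) - ∑ j, lam t.1 j • z t.1 j) := by
    rw [← Finset.sum_sub_distrib, Finset.smul_sum, Finset.sum_product,
      ← Finset.sum_subset S.subset_univ fun i _ hi => by rw [hμ_notMem hi, sub_self, smul_zero]]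
    refine Finset.sum_congr rfl fun i hi => ?_
    rw [hμ_mem hi, sum_empiricalWeight_smul, Fintype.card_fin, smul_sub,
      smul_inv_smul₀ hq0.ne', Finset.sum_sub_distrib]
    simp only [Finset.sum_const, Finset.card_univ, Fintype.card_fin, Nat.cast_smul_eq_nsmul]
  rw [← herr, norm_smul, Real.norm_natCast, Finset.sum_product] at hc
  simp only [Finset.sum_const, Finset.card_univ, Fintype.card_fin, nsmul_eq_mul,
    ← Finset.mul_sum] at hc
  refine le_of_mul_le_mul_left ?_ hq0
  linarith

end Sampling

section ApproximateShapleyFolkman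

variable {E I J : Type*} [Fintype J]

theorem sum_le_card_support_mul {a g : J → ℝ} {B : ℝ} (hB : ∀ j, g j ≤ B)
    (hg : ∀ j, a j = 0 → g j = 0) : ∑ j, g j ≤ #{j | a j ≠ 0} * B := by
  have hsupp : ∑ j with a j ≠ 0, g j = ∑ j, g j :=
    Finset.sum_filter_of_ne fun j _ hj => mt (hg j) hj
  rw [← hsupp, ← nsmul_eq_mul]
  exact Finset.sum_le_card_nsmul _ _ _ fun j _ => hB j

theorem card_support_eq_one_of_eq_one {a : J → ℝ} (ha : a ∈ stdSimplex ℝ J) {j : J}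
    (hj : a j = 1) : #{j | a j ≠ 0} = 1 := by
  classical
  have hrest : ∑ k ∈ Finset.univ.erase j, a k = 0 := by
    have := ha.2
    rwa [← Finset.add_sum_erase _ _ (Finset.mem_univ j), hj, add_eq_left] at this
  rw [Finset.sum_eq_zero_iff_of_nonneg fun k _ => ha.1 k] at hrest
  refine Finset.card_eq_one.2 ⟨j, Finset.eq_singleton_iff_unique_mem.2 ⟨?_, fun k hk => ?_⟩⟩
  · simp [hj]
  · by_contra hne
    exact (Finset.mem_filter_univ k).1 hk (hrest k (Finset.mem_erase.2 ⟨hne, Finset.mem_univ k⟩))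

theorem two_le_card_support {a : J → ℝ} (ha : ∑ j, a j = 1) (h : ∀ j, a j ≠ 1) :
    2 ≤ #{j | a j ≠ 0} := by
  obtain ⟨j, -, hj⟩ := Finset.exists_ne_zero_of_sum_ne_zero (ha.trans_ne one_ne_zero)
  refine Finset.one_lt_card.2 ?_
  by_contra! hunique
  refine h j (Eq.trans ?_ ha)
  refine (Finset.sum_eq_single j (fun k _ hk => ?_) (absurd (Finset.mem_univ j))).symm
  by_contra hk0
  exact hk (hunique k ((Finset.mem_filter_univ k).2 hk0) j ((Finset.mem_filter_univ j).2 hj))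

theorem exists_mul_le_and_le_two_mul {p b : ℕ} (hp : 0 < p) (hpb : p ≤ b) :
    ∃ q, 0 < q ∧ p * q ≤ b ∧ b ≤ 2 * (p * q) := by
  have hq : 0 < b / p := Nat.div_pos hpb hp
  have hlt : b < p * (b / p) + p := Nat.lt_mul_div_succ b hp
  exact ⟨b / p, hq, Nat.mul_div_le b p, by nlinarith⟩

variable [NormedAddCommGroup E]

theorem card_mul_sum_mul_norm_sq_le [NormedSpace ℝ E] {lam : I → J → ℝ} {z : I → J → E}
    {S : Finset I} {Rv Rl M : ℝ} (hlam : ∀ i ∈ S, lam i ∈ stdSimplex ℝ J) (hRv : 0 ≤ Rv)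
    (hM : 0 ≤ M) (hv : ∀ i ∈ S, ∀ j, ‖lam i j • z i j‖ ≤ Rv)
    (hl : ∀ i ∈ S, ∀ j, lam i j ≤ Rl) (hz : ∀ i ∈ S, ∀ j, ‖z i j‖ ≤ M) :
    4 * (#S * ∑ i ∈ S, ∑ j, lam i j * ‖z i j‖ ^ 2) ≤
      (∑ i ∈ S, (#{j | lam i j ≠ 0} : ℝ)) ^ 2 * (Rv + Rl * M) ^ 2 := by
  set N := ∑ i ∈ S, (#{j | lam i j ≠ 0} : ℝ)
  have hcard : (#S : ℝ) ≤ N * Rl := by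
    rw [← nsmul_one, ← Finset.sum_const, Finset.sum_mul]
    exact Finset.sum_le_sum fun i hi =>
      (hlam i hi).2 ▸ sum_le_card_support_mul (hl i hi) fun _ => id
  have hterm : ∀ i ∈ S, ∀ j, lam i j * ‖z i j‖ ^ 2 ≤ Rv * M := fun i hi j =>
    calc lam i j * ‖z i j‖ ^ 2 = ‖lam i j • z i j‖ * ‖z i j‖ := by
          rw [norm_smul, Real.norm_of_nonneg ((hlam i hi).1 j)]; ring
      _ ≤ Rv * M := mul_le_mul (hv i hi j) (hz i hi j) (norm_nonneg _) hRv
  have hmoment : ∑ i ∈ S, ∑ j, lam i j * ‖z i j‖ ^ 2 ≤ N * (Rv * M) := by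
    rw [Finset.sum_mul]
    exact Finset.sum_le_sum fun i hi =>
      sum_le_card_support_mul (hterm i hi) fun j hj => by rw [hj, zero_mul]
  calc 4 * (#S * ∑ i ∈ S, ∑ j, lam i j * ‖z i j‖ ^ 2)
      ≤ 4 * (#S * (N * (Rv * M))) := by gcongr
    _ ≤ 4 * ((N * Rl) * (N * (Rv * M))) := by gcongr
    _ = N ^ 2 * (4 * Rv * (Rl * M)) := by ring
    _ ≤ N ^ 2 * (Rv + Rl * M) ^ 2 := by gcongr; exact four_mul_le_sq_add _ _

variable [InnerProductSpace ℝ E] [Fintype I]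

theorem exists_resampling_card_support_le {lam : I → J → ℝ} {z : I → J → E} {S : Finset I}
    {Rv Rl M : ℝ} (hlam : ∀ i, lam i ∈ stdSimplex ℝ J) (hRv : 0 ≤ Rv) (hM : 0 ≤ M)
    (hv : ∀ i ∈ S, ∀ j, ‖lam i j • z i j‖ ≤ Rv) (hl : ∀ i ∈ S, ∀ j, lam i j ≤ Rl)
    (hz : ∀ i ∈ S, ∀ j, ‖z i j‖ ≤ M) (k : ℕ) :
    ∃ μ : I → J → ℝ, (∀ i, μ i ∈ stdSimplex ℝ J) ∧ (∀ i ∉ S, μ i = lam i) ∧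
      ∑ i ∈ S, #{j | μ i j ≠ 0} ≤ #S + k + 1 ∧
      2 * ((k + 1) * ‖∑ i, ∑ j, μ i j • z i j - ∑ i, ∑ j, lam i j • z i j‖ ^ 2) ≤
        (∑ i ∈ S, (#{j | lam i j ≠ 0} : ℝ)) ^ 2 * (Rv + Rl * M) ^ 2 := by
  obtain rfl | hS := S.eq_empty_or_nonempty
  · exact ⟨lam, hlam, fun _ _ => rfl, by simp, by simp⟩
  obtain ⟨q, hq, hq_le, hle_q⟩ :=
    exists_mul_le_and_le_two_mul hS.card_pos (by omega : #S ≤ #S + k + 1)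
  have hk : ((k + 1 : ℕ) : ℝ) ≤ (2 * (#S * q) : ℕ) := Nat.cast_le.2 (by omega)
  push_cast at hk
  obtain ⟨μ, hμ, hμS, hμSc, herr⟩ := exists_resampling hlam z S hq
  refine ⟨μ, hμ, hμSc, (Finset.sum_le_card_nsmul _ _ _ hμS).trans hq_le, ?_⟩
  set err := ‖∑ i, ∑ j, μ i j • z i j - ∑ i, ∑ j, lam i j • z i j‖ ^ 2
  calc 2 * ((k + 1) * err) ≤ 2 * (2 * (#S * q) * err) := by
        gcongr
    _ = 4 * (#S * (q * err)) := by ring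
    _ ≤ 4 * (#S * ∑ i ∈ S, ∑ j, lam i j * ‖z i j‖ ^ 2) := by gcongr
    _ ≤ _ := card_mul_sum_mul_norm_sq_le (fun i _ => hlam i) hRv hM hv hl hz

theorem exists_approximation_card_support_le {lam : I → J → ℝ} {z : I → J → E} {Rv Rl M : ℝ}
    (hlam : ∀ i, lam i ∈ stdSimplex ℝ J) (hRv : 0 ≤ Rv) (hM : 0 ≤ M)
    (hv : ∀ i j, lam i j ≠ 1 → ‖lam i j • z i j‖ ≤ Rv) (hl : ∀ i j, lam i j ≠ 1 → lam i j ≤ Rl)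
    (hz : ∀ i j, ‖z i j‖ ≤ M) {m : ℕ}
    (hcard : ∑ i, #{j | lam i j ≠ 0} ≤ Fintype.card I + m + 1) (k : ℕ) :
    ∃ μ : I → J → ℝ, (∀ i, μ i ∈ stdSimplex ℝ J) ∧
      ∑ i, #{j | μ i j ≠ 0} ≤ Fintype.card I + k + 1 ∧
      (k + 1) * ‖∑ i, ∑ j, μ i j • z i j - ∑ i, ∑ j, lam i j • z i j‖ ^ 2 ≤
        2 * (m + 1) ^ 2 * (Rv + Rl * M) ^ 2 := by
  classical
  obtain ⟨S, hS⟩ : ∃ S : Finset I, ∀ i, i ∈ S ↔ ∀ j, lam i j ≠ 1 :=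
    ⟨_, fun i => Finset.mem_filter_univ i⟩
  have hone : ∀ i ∈ Sᶜ, #{j | lam i j ≠ 0} = 1 := fun i hi => by
    obtain ⟨j, hj⟩ : ∃ j, lam i j = 1 := by simpa [hS] using hi
    exact card_support_eq_one_of_eq_one (hlam i) hj
  have hSc : ∑ i ∈ Sᶜ, #{j | lam i j ≠ 0} = #Sᶜ :=
    (Finset.sum_congr rfl hone).trans (Finset.card_eq_sum_ones _).symm
  have htwo : #S * 2 ≤ ∑ i ∈ S, #{j | lam i j ≠ 0} :=
    Finset.card_nsmul_le_sum _ _ _ fun i hi => two_le_card_support (hlam i).2 ((hS i).1 hi)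
  have hScard : #S + #Sᶜ = Fintype.card I := Finset.card_add_card_compl S
  rw [← Finset.sum_add_sum_compl S, hSc] at hcard
  obtain ⟨μ, hμ, hμSc, hμS, herr⟩ := exists_resampling_card_support_le hlam hRv hM
    (fun i hi j => hv i j ((hS i).1 hi j)) (fun i hi j => hl i j ((hS i).1 hi j))
    (fun i _ => hz i) k
  refine ⟨μ, hμ, ?_, ?_⟩
  · have hμ1 : ∑ i ∈ Sᶜ, #{j | μ i j ≠ 0} = #Sᶜ := by
      rw [← hSc]
      exact Finset.sum_congr rfl fun i hi => by rw [hμSc i (Finset.mem_compl.1 hi)]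
    rw [← Finset.sum_add_sum_compl S, hμ1]
    omega
  have hN : ((∑ i ∈ S, #{j | lam i j ≠ 0} : ℕ) : ℝ) ≤ (2 * (m + 1) : ℕ) :=
    Nat.cast_le.2 (by omega)
  push_cast at hN
  have hN0 : 0 ≤ ∑ i ∈ S, (#{j | lam i j ≠ 0} : ℝ) := Finset.sum_nonneg fun _ _ => Nat.cast_nonneg _
  have hN2 := mul_le_mul_of_nonneg_right (pow_le_pow_left₀ hN0 hN 2) (sq_nonneg (Rv + Rl * M))
  linarith

theorem approximate_shapley_folkman {lam : I → J → ℝ} {z : I → J → E} {Rv Rl M : ℝ}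
    (hlam : ∀ i, lam i ∈ stdSimplex ℝ J) (hRv : 0 ≤ Rv) (hRl : 0 ≤ Rl) (hM : 0 ≤ M)
    (hv : ∀ i j, lam i j ≠ 1 → ‖lam i j • z i j‖ ≤ Rv) (hl : ∀ i j, lam i j ≠ 1 → lam i j ≤ Rl)
    (hz : ∀ i j, ‖z i j‖ ≤ M) {m : ℕ}
    (hcard : ∑ i, #{j | lam i j ≠ 0} ≤ Fintype.card I + m + 1) {γ : ℝ} (hγ : 0 < γ) :
    ∃ μ : I → J → ℝ, (∀ i, μ i ∈ stdSimplex ℝ J) ∧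
      ((∑ i, #{j | μ i j ≠ 0} : ℕ) : ℝ) ≤ Fintype.card I + 1 + 2 * m * (4 / (γ ^ 2 + 4)) ∧
      ‖∑ i, ∑ j, μ i j • z i j - ∑ i, ∑ j, lam i j • z i j‖ ≤
        √(2 * m) * (Rv + Rl * M) * γ := by
  set b : ℝ := 2 * m * (4 / (γ ^ 2 + 4)) with hb
  have hb0 : 0 ≤ b := by positivity
  have hbγ : b * (γ ^ 2 + 4) = 8 * m := by
    rw [hb]
    field_simp
    ring
  obtain hmb | hbm := le_or_gt (m : ℝ) b
  · refine ⟨lam, hlam, ?_, by rw [sub_self, norm_zero]; positivity⟩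
    have : ((∑ i, #{j | lam i j ≠ 0} : ℕ) : ℝ) ≤ Fintype.card I + m + 1 := mod_cast hcard
    linarith
  have hm : (1 : ℝ) ≤ m := mod_cast (Nat.cast_pos (α := ℝ)).1 (hb0.trans_lt hbm)
  have hγ4 : 4 < γ ^ 2 := by nlinarith
  obtain ⟨μ, hμ, hμcard, herr⟩ :=
    exists_approximation_card_support_le hlam hRv hM hv hl hz hcard ⌊b⌋₊
  refine ⟨μ, hμ, ?_, (sq_le_sq₀ (norm_nonneg _) (by positivity)).1 ?_⟩
  · have := Nat.floor_le hb0
    have : ((∑ i, #{j | μ i j ≠ 0} : ℕ) : ℝ) ≤ Fintype.card I + ⌊b⌋₊ + 1 := mod_cast hμcard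
    linarith
  set err := ‖∑ i, ∑ j, μ i j • z i j - ∑ i, ∑ j, lam i j • z i j‖ ^ 2
  set R := (Rv + Rl * M) ^ 2
  have hscale : 8 * m * err ≤ 8 * m * (2 * m * R * γ ^ 2) :=
    calc 8 * m * err = (γ ^ 2 + 4) * (b * err) := by rw [← hbγ]; ring
      _ ≤ (γ ^ 2 + 4) * ((⌊b⌋₊ + 1) * err) := by gcongr; exact (Nat.lt_floor_add_one b).le
      _ ≤ (γ ^ 2 + 4) * (2 * (m + 1) ^ 2 * R) := by gcongr
      _ ≤ (2 * γ ^ 2) * (2 * (2 * m) ^ 2 * R) := by gcongr <;> linarith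
      _ = 8 * m * (2 * m * R * γ ^ 2) := by ring
  rw [mul_pow, mul_pow, Real.sq_sqrt (by positivity)]
  exact le_of_mul_le_mul_left hscale (by positivity)

end ApproximateShapleyFolkman

namespace SepProblem

variable {n m : ℕ} {P : SepProblem n m}

theorem radiusV_ne_top (lam : Fin n → Fin (m + 2) → ℝ) (z : Fin n → Fin (m + 2) → EpiSpace m) :
    radiusV lam z ≠ ⊤ :=
  iSup_ne_top fun _ => iSup_ne_top fun _ => iSup_ne_top fun _ => enorm_ne_top

theorem radiusLam_ne_top (lam : Fin n → Fin (m + 2) → ℝ) : radiusLam lam ≠ ⊤ :=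
  iSup_ne_top fun _ => iSup_ne_top fun _ => iSup_ne_top fun _ => enorm_ne_top

theorem enorm_smul_le_radiusV {lam : Fin n → Fin (m + 2) → ℝ}
    (z : Fin n → Fin (m + 2) → EpiSpace m) {i : Fin n} {j : Fin (m + 2)} (h : lam i j ≠ 1) :
    ‖lam i j • z i j‖ₑ ≤ radiusV lam z :=
  le_iSup₂_of_le (f := fun i j => ⨆ _ : lam i j ≠ 1, ‖lam i j • z i j‖ₑ) i j
    (le_iSup_of_le h le_rfl)

theorem enorm_le_radiusLam {lam : Fin n → Fin (m + 2) → ℝ} {i : Fin n} {j : Fin (m + 2)}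
    (h : lam i j ≠ 1) : ‖lam i j‖ₑ ≤ radiusLam lam :=
  le_iSup₂_of_le (f := fun i j => ⨆ _ : lam i j ≠ 1, ‖lam i j‖ₑ) i j (le_iSup_of_le h le_rfl)

theorem contactF_subset_setF (i : Fin n) : P.contactF i ⊆ P.setF i :=
  fun _ ⟨x, hfst, _, hsnd⟩ => ⟨x, hfst, hsnd⟩

theorem enorm_le_MV {v : Fin n → EpiSpace m} (hv : ∀ i, v i ∈ P.setF i) (i : Fin n) :
    ‖v i‖ₑ ≤ P.MV := by
  have h : ‖∑ k, (EuclideanSpace.single i (1 : ℝ) : Euc n) k • v k‖ₑ ≤ P.MV := by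
    unfold MV
    exact le_iSup₂_of_le (EuclideanSpace.single i 1) (by simp) (le_iSup₂_of_le v hv le_rfl)
  simpa [PiLp.single_apply, ite_smul] using h

theorem IsCombination.exists_nnnorm_le_MV {lam : Fin n → Fin (m + 2) → ℝ}
    {z : Fin n → Fin (m + 2) → EpiSpace m} (h : P.IsCombination lam z) :
    ∃ M : NNReal, (M : ENNReal) ≤ P.MV ∧ ∀ i j, ‖z i j‖ ≤ M := by
  refine ⟨Finset.univ.sup fun i => Finset.univ.sup fun j => ‖z i j‖₊, ?_, fun i j => ?_⟩
  · simp only [ENNReal.coe_finset_sup, Finset.sup_le_iff]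
    exact fun i _ j _ => enorm_le_MV (fun i => contactF_subset_setF i (h.2.2 i j)) i
  · exact NNReal.coe_le_coe.2 <| (Finset.le_sup (f := fun j => ‖z i j‖₊) (Finset.mem_univ j)).trans
      (Finset.le_sup (f := fun i => Finset.univ.sup fun j => ‖z i j‖₊) (Finset.mem_univ i))

theorem IsOptimalRepresentation.exists_isSparseError {x : P.Var} {w : Euc m}
    {lam : Fin n → Fin (m + 2) → ℝ} {z : Fin n → Fin (m + 2) → EpiSpace m}
    (h : P.IsOptimalRepresentation x w lam z) {γ : ℝ} (hγ : 0 < γ) :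
    ∃ u, P.IsSparseError (P.zStar x w) w (n + 1 + 2 * m * (4 / (γ ^ 2 + 4))) u ∧
      ‖u‖ₑ ≤ ENNReal.ofReal (√(2 * m)) * (radiusV lam z + radiusLam lam * P.MV) *
        ENNReal.ofReal γ := by
  obtain ⟨-, -, -, hcomb, hzStar, hcard⟩ := h
  obtain ⟨M, hM_le, hM⟩ := hcomb.exists_nnnorm_le_MV
  lift radiusV lam z to NNReal using radiusV_ne_top lam z with Rv hRv
  lift radiusLam lam to NNReal using radiusLam_ne_top lam with Rl hRl
  have hv (i j) (hij : lam i j ≠ 1) : ‖lam i j • z i j‖ ≤ Rv :=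
    ENNReal.coe_le_coe.1 (hRv ▸ enorm_smul_le_radiusV z hij)
  have hl (i j) (hij : lam i j ≠ 1) : lam i j ≤ Rl :=
    (Real.le_norm_self _).trans (ENNReal.coe_le_coe.1 (hRl ▸ enorm_le_radiusLam hij))
  obtain ⟨μ, hμ, hsparse, herr⟩ := approximate_shapley_folkman
    (fun i => ⟨hcomb.1 i, hcomb.2.1 i⟩) Rv.2 Rl.2 M.2 hv hl hM
    (by rw [Fintype.card_fin]; exact hcard) hγ
  rw [Fintype.card_fin] at hsparse
  refine ⟨_, ⟨μ, z, ⟨fun i => (hμ i).1, fun i => (hμ i).2, hcomb.2.2⟩, hsparse, rfl⟩, ?_⟩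
  rw [hzStar, add_sub_add_right_eq_sub, ← ofReal_norm]
  calc ENNReal.ofReal _ ≤ ENNReal.ofReal (√(2 * m) * (Rv + Rl * M) * γ) :=
        ENNReal.ofReal_le_ofReal herr
    _ = ENNReal.ofReal (√(2 * m)) * (Rv + Rl * M) * ENNReal.ofReal γ := by
        rw [ENNReal.ofReal_mul (by positivity), ENNReal.ofReal_mul (by positivity),
          ← ENNReal.coe_mul, ← ENNReal.coe_add, ← ENNReal.ofReal_coe_nnreal]
        norm_cast
    _ ≤ _ := by gcongr

end SepProblem

theorem EpiSpace.max_enorm_le {m : ℕ} (u : EpiSpace m) : max ‖u.fst‖ₑ ‖u.snd‖ₑ ≤ ‖u‖ₑ :=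
  max_le (WithLp.enorm_fst_le _ u) (WithLp.enorm_snd_le _ u)

theorem mainTheorem7 :
    ∃ c : ℝ, 0 < c ∧
      ∀ (n m : ℕ) (P : SepProblem n m), (∀ i, GoodFunction (P.f i)) → P.hCoP 0 < ⊤ →
        (∃ x w lam z, P.IsOptimalRepresentation x w lam z) ∧
        ∀ x w lam z, P.IsOptimalRepresentation x w lam z →
          ∀ γ s : ℝ, 0 < γ → s = n + 1 + 2 * m * (c / (γ ^ 2 + c)) →
            (∃ u, P.IsSparseError (P.zStar x w) w s u ∧ P.GapBound s u ∧
              max ‖u.fst‖ₑ ‖u.snd‖ₑ ≤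
                ENNReal.ofReal (√(2 * m)) *
                  (SepProblem.radiusV lam z + SepProblem.radiusLam lam * P.MV) *
                  ENNReal.ofReal γ) ∧
            ∀ u, P.IsSparseError (P.zStar x w) w s u →
              (∀ u', P.IsSparseError (P.zStar x w) w s u' → ‖u‖ ≤ ‖u'‖) →
              P.GapBound s u ∧
              max ‖u.fst‖ₑ ‖u.snd‖ₑ ≤
                ENNReal.ofReal (√(2 * m)) *
                  (SepProblem.radiusV lam z + SepProblem.radiusLam lam * P.MV) *
                  ENNReal.ofReal γ := by
  refine ⟨4, four_pos, fun n m P hf hP => ⟨SepProblem.exists_isOptimalRepresentation hf hP, ?_⟩⟩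
  rintro x w lam z hrep γ _ hγ rfl
  obtain ⟨u, hu, hbound⟩ := hrep.exists_isSparseError hγ
  refine ⟨⟨u, hu, hu.gapBound hf hrep.1, u.max_enorm_le.trans hbound⟩, fun v hv hmin => ?_⟩
  have hle : ‖v‖ₑ ≤ ‖u‖ₑ := enorm_le_iff_norm_le.2 (hmin u hu)
  exact ⟨hv.gapBound hf hrep.1, v.max_enorm_le.trans (hle.trans hbound)⟩
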